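/- Let $\mathbb S^1=\mathbb R/\mathbb Z$. For $n\ge 1$ let $C^n(\mathbb S^1)$ be the Banach space of real functions of class $C^n$ on $\mathbb S^1$, with norm $\|f\|=\max_{k\le n}\sup|\partial_x^k f|$, and let $\mathrm{Diff}^n(\mathbb S^1)$ be the set of orientation-preserving diffeomorphisms of $\mathbb S^1$ of class $C^n$, with its usual structure of a smooth Banach manifold modelled on $C^n(\mathbb S^1)$ (the chart centred at $\varphi$ sends $\psi$ uniformly close to $\varphi$ to the function $f$ with small values such that $\psi=\varphi+f$ modulo $\mathbb Z$); its tangent spaces are thereby identified with $C^n(\mathbb S^1)$. Put $\mu(f)=\int_0^1 f\,dx$ and $A=\mu-\partial_x^2$, which maps $C^{k+2}(\mathbb S^1)$ bijectively onto $C^k(\mathbb S^1)$ for every $k\ge0$, and $$P(f)=3A^{-1}\big(f_xf_{xx}+(Af)f_x\big),\qquad P_\varphi(\xi)=P(\xi\circ\varphi^{-1})\circ\varphi,\qquad F(\varphi,\xi)=\big(\xi,-P_\varphi(\xi)\big)$$ for $(\varphi,\xi)\in\mathrm{Diff}^n(\mathbb S^1)\times C^n(\mathbb S^1)$. **Theorem.**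 Let $n\ge 3$. There are an open interval $J_n=(-\varepsilon_n,\varepsilon_n)$, $\varepsilon_n>0$, and an open ball $B(0,\delta_n)\subset C^n(\mathbb S^1)$, $\delta_n>0$, such that for every $u_0\in B(0,\delta_n)$ there is a unique solution $(\varphi,\xi)\in C^\infty\big(J_n,\mathrm{Diff}^n(\mathbb S^1)\times C^n(\mathbb S^1)\big)$ of $$(\varphi_t,\xi_t)=F(\varphi,\xi)\ \text{ on } J_n,\qquad \varphi(0)=\mathrm{id},\quad \xi(0)=u_0 .$$ Moreover, the map $(t,u_0)\mapsto(\varphi(t),\xi(t))$ from $J_n\times B(0,\delta_n)$ to $\mathrm{Diff}^n(\mathbb S^1)\times C^n(\mathbb S^1)$ is of class $C^\infty$. -/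

import Mathlib

open Set Function Metric
open scoped Manifold ContDiff Topology

noncomputable section

namespace MuDP

/-! ### Functions on the circle `ℝ / ℤ` -/

/-- The derivative `f_x` of a function on the circle, `f_x(p) = d/ds f(p + s)` at `s = 0`. -/
def dx (f : UnitAddCircle → ℝ) : UnitAddCircle → ℝ :=
  fun p => deriv (fun s : ℝ => f (p + (s : UnitAddCircle))) 0

/-- `f` is of class `C^k` on the circle: its pull-back to the real line is of class `C^k`. -/
def IsC (k : ℕ) (f : UnitAddCircle → ℝ) : Prop :=
  ContDiff ℝ k (fun x : ℝ => f (x : UnitAddCircle))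

theorem dx_coe (f : UnitAddCircle → ℝ) (x : ℝ) :
    dx f (x : UnitAddCircle) = deriv (fun y : ℝ => f (y : UnitAddCircle)) x := by
  have h := deriv_comp_const_add (f := fun y : ℝ => f (y : UnitAddCircle)) x 0
  simp only [add_zero] at h
  rw [← h]
  simp [dx]

theorem pull_dx (f : UnitAddCircle → ℝ) :
    (fun x : ℝ => dx f (x : UnitAddCircle)) = deriv (fun y : ℝ => f (y : UnitAddCircle)) :=
  funext (dx_coe f)

theorem IsC.dx {k : ℕ} {f : UnitAddCircle → ℝ} (hf : IsC (k + 1) f) : IsC k (dx f) := by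
  unfold IsC at hf ⊢
  rw [pull_dx]
  have h2 : ContDiff ℝ ((k : WithTop ℕ∞) + 1) (fun x : ℝ => f (x : UnitAddCircle)) := by
    exact_mod_cast hf
  exact (contDiff_succ_iff_deriv.1 h2).2.2

theorem IsC.mono {k l : ℕ} (h : k ≤ l) {f : UnitAddCircle → ℝ} (hf : IsC l f) : IsC k f :=
  ContDiff.of_le hf (by exact_mod_cast h)

theorem IsC.iter_dx {k : ℕ} {f : UnitAddCircle → ℝ} :
    ∀ {j : ℕ}, IsC (k + j) f → IsC k (MuDP.dx^[j] f) := by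
  intro j
  induction j generalizing f with
  | zero => intro h; simpa using h
  | succ j ih =>
    intro h
    rw [Function.iterate_succ_apply]
    exact ih (IsC.dx (by simpa [add_assoc] using h))

theorem IsC.add {k : ℕ} {f g : UnitAddCircle → ℝ} (hf : IsC k f) (hg : IsC k g) :
    IsC k (f + g) := ContDiff.add hf hg

theorem IsC.mul {k : ℕ} {f g : UnitAddCircle → ℝ} (hf : IsC k f) (hg : IsC k g) :
    IsC k (f * g) := ContDiff.mul hf hg

theorem IsC.smul {k : ℕ} {f : UnitAddCircle → ℝ} (c : ℝ) (hf : IsC k f) :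
    IsC k (c • f) := ContDiff.const_smul c hf

theorem IsC.const {k : ℕ} (c : ℝ) : IsC k (fun _ => c) := contDiff_const

theorem continuous_of_pull {Y : Type*} [TopologicalSpace Y] {f : UnitAddCircle → Y}
    (h : Continuous (fun x : ℝ => f (x : UnitAddCircle))) : Continuous f :=
  (QuotientAddGroup.isQuotientMap_mk _).continuous_iff.2 h

theorem IsC.continuous {k : ℕ} {f : UnitAddCircle → ℝ} (hf : IsC k f) : Continuous f :=
  continuous_of_pull (ContDiff.continuous hf)

theorem IsC.differentiable {k : ℕ} (hk : 1 ≤ k) {f : UnitAddCircle → ℝ} (hf : IsC k f) :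
    Differentiable ℝ (fun x : ℝ => f (x : UnitAddCircle)) :=
  ContDiff.differentiable hf (by exact_mod_cast (by omega : k ≠ 0))

theorem dx_add {f g : UnitAddCircle → ℝ} (hf : IsC 1 f) (hg : IsC 1 g) :
    dx (f + g) = dx f + dx g := by
  funext p
  induction p using QuotientAddGroup.induction_on with
  | H x =>
    have h1 := (hf.differentiable le_rfl) x
    have h2 := (hg.differentiable le_rfl) x
    have := deriv_add h1 h2
    simp only [Pi.add_apply]
    erw [dx_coe, dx_coe, dx_coe]
    exact this

theorem dx_smul (c : ℝ) {f : UnitAddCircle → ℝ} (hf : IsC 1 f) :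
    dx (c • f) = c • dx f := by
  funext p
  induction p using QuotientAddGroup.induction_on with
  | H x =>
    have h1 := (hf.differentiable le_rfl) x
    simp only [Pi.smul_apply]
    erw [dx_coe, dx_coe]
    exact deriv_const_smul c h1

theorem iter_dx_add {j : ℕ} {f g : UnitAddCircle → ℝ} (hf : IsC j f) (hg : IsC j g) :
    dx^[j] (f + g) = dx^[j] f + dx^[j] g := by
  induction j generalizing f g with
  | zero => rfl
  | succ j ih =>
    simp only [Function.iterate_succ_apply]
    rw [dx_add (hf.mono (by omega)) (hg.mono (by omega)), ih hf.dx hg.dx]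

theorem iter_dx_smul {j : ℕ} (c : ℝ) {f : UnitAddCircle → ℝ} (hf : IsC j f) :
    dx^[j] (c • f) = c • dx^[j] f := by
  induction j generalizing f with
  | zero => rfl
  | succ j ih =>
    simp only [Function.iterate_succ_apply]
    rw [dx_smul c (hf.mono (by omega)), ih hf.dx]

/-! ### The Banach space `C^n(S¹)` -/

/-- The vector space of real functions of class `C^n` on the circle. -/
def CSub (n : ℕ) : Submodule ℝ (UnitAddCircle → ℝ) where
  carrier := {f | IsC n f}
  add_mem' := IsC.add
  zero_mem' := IsC.const 0
  smul_mem' c _ := IsC.smul c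

/-- The space `C^n(S¹)`. -/
def C (n : ℕ) : Type := ↥(CSub n)

namespace C

variable {n : ℕ}

instance : AddCommGroup (C n) := inferInstanceAs (AddCommGroup ↥(CSub n))
instance : Module ℝ (C n) := inferInstanceAs (Module ℝ ↥(CSub n))

/-- The element of `C^n(S¹)` given by a function of class `C^n`. -/
def mk (f : UnitAddCircle → ℝ) (hf : IsC n f) : C n := ⟨f, hf⟩

instance : FunLike (C n) UnitAddCircle ℝ where
  coe := fun f : ↥(CSub n) => f.1
  coe_injective := Subtype.val_injective

theorem isC (f : C n) : IsC n f := Subtype.property (p := fun f => f ∈ CSub n) f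
@[simp] theorem coe_mk (f : UnitAddCircle → ℝ) (hf : IsC n f) : (mk f hf : UnitAddCircle → ℝ) = f :=
  rfl
@[simp] theorem coe_add (f g : C n) : ((f + g : C n) : UnitAddCircle → ℝ) = f + g := rfl
@[simp] theorem coe_sub (f g : C n) : ((f - g : C n) : UnitAddCircle → ℝ) = f - g := rfl
@[simp] theorem coe_zero : ((0 : C n) : UnitAddCircle → ℝ) = 0 := rfl
@[simp] theorem coe_neg (f : C n) : ((-f : C n) : UnitAddCircle → ℝ) = -f := rfl
@[simp] theorem coe_smul (c : ℝ) (f : C n) : ((c • f : C n) : UnitAddCircle → ℝ) = c • (f : UnitAddCircle → ℝ) :=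
  rfl
theorem ext {f g : C n} (h : ∀ p, f p = g p) : f = g := DFunLike.ext f g h

/-- The derivatives `(f, f_x, …, ∂_x^n f)` of `f`, as continuous functions on the circle. -/
def jet (n : ℕ) : C n →ₗ[ℝ] (Fin (n + 1) → C(UnitAddCircle, ℝ)) where
  toFun f := fun k => ⟨dx^[(k : ℕ)] f,
    (IsC.iter_dx (k := 0) (f.isC.mono (by have := k.2; omega))).continuous⟩
  map_add' f g := by
    funext k
    ext p
    exact congrFun (iter_dx_add (f.isC.mono (by have := k.2; omega))
      (g.isC.mono (by have := k.2; omega))) p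
  map_smul' c f := by
    funext k
    ext p
    exact congrFun (iter_dx_smul c (f.isC.mono (by have := k.2; omega))) p

theorem jet_apply (f : C n) (k : Fin (n + 1)) (p : UnitAddCircle) :
    jet n f k p = (dx^[(k : ℕ)] f) p := rfl

theorem jet_injective : Injective (jet n) := by
  intro f g h
  refine ext fun p => ?_
  have := congrArg (fun F : Fin (n + 1) → C(UnitAddCircle, ℝ) => F 0 p) h
  simpa [jet_apply] using this

/-- The norm of `C^n(S¹)`: `‖f‖ = max_{k ≤ n} sup |∂_x^k f|`. -/
instance : NormedAddCommGroup (C n) := NormedAddCommGroup.induced _ _ (jet n) jet_injective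

instance : NormedSpace ℝ (C n) := NormedSpace.induced ℝ _ _ (jet n)

theorem norm_def (f : C n) : ‖f‖ = ‖jet n f‖ := rfl

theorem abs_iter_dx_le (f : C n) {k : ℕ} (hk : k ≤ n) (p : UnitAddCircle) :
    |(dx^[k] f) p| ≤ ‖f‖ := by
  have h1 := norm_le_pi_norm (jet n f) ⟨k, by omega⟩
  have h2 := (jet n f ⟨k, by omega⟩).norm_coe_le_norm p
  rw [norm_def]
  exact h2.trans h1

theorem abs_le (f : C n) (p : UnitAddCircle) : |f p| ≤ ‖f‖ := f.abs_iter_dx_le (Nat.zero_le n) p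

end C

/-! ### The group `Diff^n(S¹)` -/

/-- `φ` is an orientation-preserving diffeomorphism of class `C^n` of the circle (`n ≥ 1`): it is
covered by a map `L : ℝ → ℝ` of class `C^n` with positive derivative and `L(x + 1) = L(x) + 1`. -/
def IsDiff (n : ℕ) (φ : UnitAddCircle → UnitAddCircle) : Prop :=
  ∃ L : ℝ → ℝ, ContDiff ℝ n L ∧ (∀ x, 0 < deriv L x) ∧ (∀ x, L (x + 1) = L x + 1) ∧
    ∀ x : ℝ, φ (x : UnitAddCircle) = (L x : UnitAddCircle)

/-- The set `Diff^n(S¹)` of orientation-preserving `C^n`-diffeomorphisms of the circle. -/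
structure D (n : ℕ) where
  /-- The underlying map of the circle. -/
  toFun : UnitAddCircle → UnitAddCircle
  isDiff' : IsDiff n toFun

theorem coe_eq_coe_iff (x y : ℝ) :
    (x : UnitAddCircle) = (y : UnitAddCircle) ↔ ∃ m : ℤ, x = y + m := by
  rw [← sub_eq_zero, ← AddCircle.coe_sub, AddCircle.coe_eq_zero_iff]
  constructor
  · rintro ⟨m, hm⟩
    exact ⟨m, by simp at hm; linarith⟩
  · rintro ⟨m, hm⟩
    exact ⟨m, by simp; linarith⟩

theorem lift_add_int {L : ℝ → ℝ} (h : ∀ x, L (x + 1) = L x + 1) (x : ℝ) (m : ℤ) :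
    L (x + m) = L x + m := by
  induction m using Int.induction_on with
  | zero => simp
  | succ i ih =>
    push_cast at ih ⊢
    rw [← add_assoc, h, ih]; ring
  | pred i ih =>
    push_cast at ih ⊢
    have := h (x + (-(i : ℝ) - 1))
    rw [show x + (-(i : ℝ) - 1) + 1 = x + -(i : ℝ) by ring, ih] at this
    linarith

/-- The lift of a diffeomorphism of the circle is a homeomorphism of the line. -/
theorem exists_homeomorph {L : ℝ → ℝ} (hc : Continuous L) (hd : ∀ x, 0 < deriv L x)
    (h1 : ∀ x, L (x + 1) = L x + 1) : ∃ H : ℝ ≃ₜ ℝ, ∀ x, H x = L x := by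
  have hm : StrictMono L := strictMono_of_deriv_pos hd
  have hs : Surjective L := by
    intro y
    obtain ⟨N, hN⟩ := exists_int_gt (y - L 0)
    obtain ⟨M, hM⟩ := exists_int_lt (y - L 0)
    have hNv := lift_add_int h1 0 N
    have hMv := lift_add_int h1 0 M
    rw [zero_add] at hNv hMv
    have hMN : (M : ℝ) ≤ N := by linarith
    obtain ⟨x, -, hx⟩ := intermediate_value_Icc hMN hc.continuousOn
      (show y ∈ Icc (L M) (L N) from ⟨by linarith, by linarith⟩)
    exact ⟨x, hx⟩
  exact ⟨(hm.orderIsoOfSurjective L hs).toHomeomorph, fun x => rfl⟩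

theorem IsDiff.bijective {n : ℕ} {φ : UnitAddCircle → UnitAddCircle} (h : IsDiff n φ) :
    Bijective φ := by
  obtain ⟨L, hL, hd, h1, hφ⟩ := h
  obtain ⟨H, hH⟩ := exists_homeomorph hL.continuous hd h1
  constructor
  · intro p q
    induction p using QuotientAddGroup.induction_on with
    | H x =>
      induction q using QuotientAddGroup.induction_on with
      | H y =>
        intro hpq
        erw [hφ, hφ] at hpq
        obtain ⟨m, hm⟩ := (coe_eq_coe_iff _ _).1 hpq
        rw [← lift_add_int h1, ← hH, ← hH] at hm
        exact (coe_eq_coe_iff _ _).2 ⟨m, H.injective hm⟩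
  · intro q
    induction q using QuotientAddGroup.induction_on with
    | H y =>
      refine ⟨((H.symm y : ℝ) : UnitAddCircle), ?_⟩
      rw [hφ, ← hH, H.apply_symm_apply]

namespace D

variable {n : ℕ}

instance : FunLike (D n) UnitAddCircle UnitAddCircle where
  coe := toFun
  coe_injective := fun φ ψ h => by cases φ; cases ψ; congr

theorem ext {φ ψ : D n} (h : ∀ p, φ p = ψ p) : φ = ψ := DFunLike.ext φ ψ h

theorem isDiff (φ : D n) : IsDiff n φ := φ.isDiff'

@[simp] theorem coe_mk (φ : UnitAddCircle → UnitAddCircle) (h : IsDiff n φ) :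
    ((⟨φ, h⟩ : D n) : UnitAddCircle → UnitAddCircle) = φ := rfl

/-- A diffeomorphism of the circle as a bijection of the circle. -/
def toEquiv (φ : D n) : UnitAddCircle ≃ UnitAddCircle := Equiv.ofBijective φ φ.isDiff.bijective

/-- The identity of the circle. -/
def id (n : ℕ) : D n :=
  ⟨fun p => p, fun x => x, contDiff_id, fun x => by simp, fun _ => rfl, fun _ => rfl⟩

theorem continuous (φ : D n) : Continuous φ := by
  obtain ⟨L, hL, -, -, hφ⟩ := φ.isDiff
  refine continuous_of_pull ?_
  simp only [hφ]
  exact (AddCircle.continuous_mk' 1).comp hL.continuous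

end D

/-- Composition of a `C^n`-function with a `C^n`-diffeomorphism is of class `C^n`. -/
theorem IsC.comp_diff {n : ℕ} {f : UnitAddCircle → ℝ} (hf : IsC n f) (φ : D n) :
    IsC n (f ∘ φ) := by
  obtain ⟨L, hL, -, -, hφ⟩ := φ.isDiff
  unfold IsC at hf ⊢
  simp only [Function.comp_apply, hφ]
  exact hf.comp hL

/-- Composition of a `C^n`-function with the inverse of a `C^n`-diffeomorphism is of class `C^n`. -/
theorem IsC.comp_symm {n : ℕ} (hn : 1 ≤ n) {f : UnitAddCircle → ℝ} (hf : IsC n f) (φ : D n) :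
    IsC n (f ∘ φ.toEquiv.symm) := by
  obtain ⟨L, hL, hd, h1, hφ⟩ := φ.isDiff
  obtain ⟨H, hH⟩ := exists_homeomorph hL.continuous hd h1
  have hHL : (H : ℝ → ℝ) = L := funext hH
  have hs : ContDiff ℝ n (H.symm : ℝ → ℝ) := by
    refine H.contDiff_symm_deriv (f' := deriv L) (fun x => (hd x).ne') (fun x => ?_)
      (by rw [hHL]; exact hL)
    rw [hHL]
    exact (hL.differentiable (by exact_mod_cast (by omega : n ≠ 0)) x).hasDerivAt
  have key : ∀ x : ℝ, φ.toEquiv.symm (x : UnitAddCircle) = ((H.symm x : ℝ) : UnitAddCircle) := by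
    intro x
    rw [Equiv.symm_apply_eq]
    change _ = φ _
    rw [hφ, ← hH, H.apply_symm_apply]
  unfold IsC at hf ⊢
  simp only [Function.comp_apply, key]
  exact hf.comp hs

/-! ### The manifold structure of `Diff^n(S¹)` -/

/-- The representative in `[-1/2, 1/2)` of a point of the circle. -/
def rep (q : UnitAddCircle) : ℝ := (AddCircle.equivIco 1 (-1 / 2) q : ℝ)

@[simp] theorem coe_rep (q : UnitAddCircle) : ((rep q : ℝ) : UnitAddCircle) = q :=
  AddCircle.coe_equivIco

theorem rep_coe {y : ℝ} (hy : |y| < 1 / 2) : rep (y : UnitAddCircle) = y := by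
  have h := abs_lt.1 hy
  exact congrArg Subtype.val
    (AddCircle.equivIco_coe_eq (p := (1 : ℝ)) (a := -1 / 2) (x := y)
      ⟨by linarith [h.1], by linarith [h.2]⟩)

theorem abs_rep (q : UnitAddCircle) : |rep q| = ‖q‖ := by
  have hm : rep q ∈ Ico (-1 / 2 : ℝ) (-1 / 2 + 1) := (AddCircle.equivIco 1 (-1 / 2) q).2
  have h2 : |rep q| ≤ |(1 : ℝ)| / 2 := by
    rw [abs_le, abs_one]
    exact ⟨by linarith [hm.1], by linarith [hm.2]⟩
  rw [← (AddCircle.norm_coe_eq_abs_iff (1 : ℝ) one_ne_zero).2 h2]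
  exact congrArg norm (coe_rep q)

theorem norm_coe_le (y : ℝ) : ‖(y : UnitAddCircle)‖ ≤ |y| := by
  rw [UnitAddCircle.norm_eq]
  simpa using round_le y 0

theorem rep_add {q : UnitAddCircle} {s : ℝ} (hq : ‖q‖ < 1 / 4) (hs : |s| < 1 / 4) :
    rep (q + (s : UnitAddCircle)) = rep q + s := by
  rw [← abs_rep] at hq
  have : q + (s : UnitAddCircle) = ((rep q + s : ℝ) : UnitAddCircle) := by
    rw [AddCircle.coe_add, coe_rep]
  rw [this, rep_coe]
  exact (abs_add_le _ _).trans_lt (by linarith)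

theorem isC_rep_sub {n : ℕ} (φ ψ : D n) (h : ∀ p, ‖ψ p - φ p‖ < 1 / 4) :
    IsC n (fun p => rep (ψ p - φ p)) := by
  obtain ⟨L, hL, -, -, hφ⟩ := φ.isDiff
  obtain ⟨K, hK, -, -, hψ⟩ := ψ.isDiff
  refine contDiff_iff_contDiffAt.2 fun x₀ => ?_
  have hc : ContDiff ℝ n (fun x => rep (ψ (x₀ : UnitAddCircle) - φ (x₀ : UnitAddCircle)) +
      ((K x - L x) - (K x₀ - L x₀))) := by fun_prop
  refine hc.contDiffAt.congr_of_eventuallyEq ?_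
  have hev : ∀ᶠ x in 𝓝 x₀, |(K x - L x) - (K x₀ - L x₀)| < 1 / 4 := by
    have hcont : Continuous fun x => |(K x - L x) - (K x₀ - L x₀)| := by
      have := hL.continuous
      have := hK.continuous
      fun_prop
    exact hcont.continuousAt.eventually_lt continuousAt_const (by simp)
  filter_upwards [hev] with x hx
  rw [← rep_add (h _) hx]
  congr 1
  rw [hφ, hφ, hψ, hψ]
  simp only [AddCircle.coe_sub]
  abel

theorem dx_pos_margin {n : ℕ} (hn : 1 ≤ n) {L : ℝ → ℝ} (hL : ContDiff ℝ n L)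
    (hd : ∀ x, 0 < deriv L x) (h1 : ∀ x, L (x + 1) = L x + 1) :
    ∃ m > 0, ∀ x, m ≤ deriv L x := by
  have hper : ∀ x, deriv L (x + 1) = deriv L x := by
    intro x
    have e1 := deriv_comp_add_const (f := L) 1 x
    rw [← e1]
    simp only [h1]
    exact deriv_add_const _
  have hc : Continuous (deriv L) := hL.continuous_deriv (by exact_mod_cast hn)
  obtain ⟨x₀, -, hx₀⟩ := isCompact_Icc.exists_isMinOn (s := Icc (0 : ℝ) 1) ⟨0, by simp⟩
    hc.continuousOn
  refine ⟨deriv L x₀, hd x₀, fun x => ?_⟩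
  have hp : Function.Periodic (deriv L) 1 := hper
  obtain ⟨y, hy, hxy⟩ := hp.exists_mem_Ico₀ one_pos x
  rw [hxy]
  exact hx₀ ⟨hy.1, hy.2.le⟩

/-- A small perturbation of a diffeomorphism is a diffeomorphism. -/
theorem isDiff_perturb {n : ℕ} (hn : 1 ≤ n) (φ : UnitAddCircle → UnitAddCircle) (h : IsDiff n φ) :
    ∃ ε > 0, ∀ f : C n, ‖f‖ < ε → IsDiff n (fun p => φ p + (f p : UnitAddCircle)) := by
  obtain ⟨L, hL, hd, h1, hφ⟩ := h
  obtain ⟨m, hm, hmL⟩ := dx_pos_margin hn hL hd h1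
  refine ⟨m, hm, fun f hf => ⟨fun x => L x + f (x : UnitAddCircle), hL.add f.isC, fun x => ?_,
    fun x => ?_, fun x => ?_⟩⟩
  · have e : deriv (fun x : ℝ => L x + f (x : UnitAddCircle)) x = deriv L x + dx f x := by
      rw [dx_coe]
      exact deriv_add ((hL.differentiable (by exact_mod_cast (by omega : n ≠ 0))) x)
        (f.isC.differentiable hn x)
    rw [e]
    have h2 := f.abs_iter_dx_le hn (x : UnitAddCircle)
    simp only [Function.iterate_one] at h2
    have h3 := neg_le_of_abs_le h2
    have h4 := hmL x
    linarith
  · have : ((x + 1 : ℝ) : UnitAddCircle) = x := AddCircle.coe_add_period 1 x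
    simp only [this, h1]; ring
  · simp only [AddCircle.coe_add, hφ]

theorem norm_margin {g : UnitAddCircle → ℝ} (hg : Continuous g) {c : ℝ} (h : ∀ p, g p < c) :
    ∃ ε > 0, ∀ p, g p + ε < c := by
  obtain ⟨p₀, -, hp₀⟩ := isCompact_univ.exists_isMaxOn (s := (univ : Set UnitAddCircle))
    ⟨0, mem_univ _⟩ hg.continuousOn
  refine ⟨(c - g p₀) / 2, by linarith [h p₀], fun p => ?_⟩
  have : g p ≤ g p₀ := hp₀ (mem_univ p)
  linarith [h p₀]

open Classical in
/-- The chart of `Diff^n(S¹)` centred at `φ`: a diffeomorphism `ψ` that is uniformly close to `φ` is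
sent to the `C^n`-function `f` with small values such that `ψ(p) = φ(p) + f(p)` on `ℝ / ℤ`. -/
def chart {n : ℕ} (φ : D n) : PartialEquiv (D n) (C n) where
  source := {ψ | ∀ p, ‖ψ p - φ p‖ < 1 / 4}
  target := {f | (∀ p, |f p| < 1 / 4) ∧ IsDiff n (fun p => φ p + (f p : UnitAddCircle))}
  toFun ψ := if h : ∀ p, ‖ψ p - φ p‖ < 1 / 4 then C.mk _ (isC_rep_sub φ ψ h) else 0
  invFun f := if h : IsDiff n (fun p => φ p + (f p : UnitAddCircle)) then ⟨_, h⟩ else φ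
  map_source' ψ h := by
    have h' : ∀ p, ‖ψ p - φ p‖ < 1 / 4 := h
    rw [dif_pos h']
    refine ⟨fun p => ?_, ?_⟩
    · simpa only [C.coe_mk, abs_rep] using h' p
    · simpa only [C.coe_mk, coe_rep, add_sub_cancel] using ψ.isDiff
  map_target' f h := by
    rw [dif_pos h.2]
    intro p
    change ‖φ p + (f p : UnitAddCircle) - φ p‖ < 1 / 4
    rw [add_sub_cancel_left]
    exact (norm_coe_le _).trans_lt (h.1 p)
  left_inv' ψ h := by
    have h' : ∀ p, ‖ψ p - φ p‖ < 1 / 4 := h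
    have h2 : IsDiff n (fun p => φ p + (rep (ψ p - φ p) : UnitAddCircle)) := by
      simpa only [coe_rep, add_sub_cancel] using ψ.isDiff
    simp only [dif_pos h', C.coe_mk, dif_pos h2]
    refine D.ext fun p => ?_
    change φ p + (rep (ψ p - φ p) : UnitAddCircle) = ψ p
    rw [coe_rep, add_sub_cancel]
  right_inv' f h := by
    have h' : ∀ p, ‖φ p + (f p : UnitAddCircle) - φ p‖ < 1 / 4 := fun p => by
      rw [add_sub_cancel_left]
      exact (norm_coe_le _).trans_lt (h.1 p)
    simp only [dif_pos h.2]
    refine (dif_pos h').trans ?_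
    refine C.ext fun p => ?_
    change rep (φ p + (f p : UnitAddCircle) - φ p) = f p
    rw [add_sub_cancel_left]
    exact rep_coe ((h.1 p).trans (by norm_num))

theorem chart_apply {n : ℕ} (φ ψ : D n) (h : ψ ∈ (chart φ).source) (p : UnitAddCircle) :
    chart φ ψ p = rep (ψ p - φ p) := by
  have h' : ∀ p, ‖ψ p - φ p‖ < 1 / 4 := h
  have : chart φ ψ = C.mk _ (isC_rep_sub φ ψ h') := dif_pos h'
  rw [this]
  rfl

theorem chart_symm_apply {n : ℕ} (φ : D n) (f : C n) (h : f ∈ (chart φ).target)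
    (p : UnitAddCircle) : (chart φ).symm f p = φ p + (f p : UnitAddCircle) := by
  have : (chart φ).symm f = ⟨_, h.2⟩ := dif_pos h.2
  rw [this]
  rfl

/-- A change of charts is locally a translation of `C^n(S¹)`, and its domain is open. -/
theorem chart_trans {n : ℕ} (hn : 1 ≤ n) (φ ψ : D n) (f₀ : C n)
    (h₀ : f₀ ∈ ((chart φ).symm.trans (chart ψ)).source) :
    ∃ ε > 0, ∀ f ∈ ball f₀ ε, f ∈ ((chart φ).symm.trans (chart ψ)).source ∧
      ((chart φ).symm.trans (chart ψ)) f = ((chart φ).symm.trans (chart ψ)) f₀ + (f - f₀) := by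
  rw [PartialEquiv.trans_source] at h₀
  obtain ⟨ht, hs⟩ := h₀
  have ht : f₀ ∈ (chart φ).target := ht
  have hs : ∀ p, ‖(chart φ).symm f₀ p - ψ p‖ < 1 / 4 := hs
  simp only [chart_symm_apply φ f₀ ht] at hs
  obtain ⟨ε₁, hε₁, H₁⟩ := isDiff_perturb hn _ ht.2
  obtain ⟨ε₂, hε₂, H₂⟩ := norm_margin (g := fun p => |f₀ p|) f₀.isC.continuous.abs ht.1
  have hcs : Continuous fun p => ‖φ p + (f₀ p : UnitAddCircle) - ψ p‖ :=
    ((φ.continuous.add ((AddCircle.continuous_mk' 1).comp f₀.isC.continuous)).sub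
      ψ.continuous).norm
  obtain ⟨ε₃, hε₃, H₃⟩ := norm_margin hcs hs
  refine ⟨min (min ε₁ ε₂) (min ε₃ (1 / 4)), by positivity, fun f hf => ?_⟩
  rw [mem_ball, dist_eq_norm] at hf
  have k1 : ‖f - f₀‖ < ε₁ := hf.trans_le ((min_le_left _ _).trans (min_le_left _ _))
  have k2 : ‖f - f₀‖ < ε₂ := hf.trans_le ((min_le_left _ _).trans (min_le_right _ _))
  have k3 : ‖f - f₀‖ < ε₃ := hf.trans_le ((min_le_right _ _).trans (min_le_left _ _))
  have k4 : ‖f - f₀‖ < 1 / 4 := hf.trans_le ((min_le_right _ _).trans (min_le_right _ _))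
  have hv : ∀ p, |f p - f₀ p| ≤ ‖f - f₀‖ := fun p => (f - f₀).abs_le p
  have hsum : ∀ p, φ p + (f p : UnitAddCircle) =
      φ p + (f₀ p : UnitAddCircle) + ((f p - f₀ p : ℝ) : UnitAddCircle) := fun p => by
    rw [AddCircle.coe_sub]; abel
  have hft : f ∈ (chart φ).target := by
    refine ⟨fun p => ?_, ?_⟩
    · have a1 := abs_add_le (f₀ p) (f p - f₀ p)
      rw [add_sub_cancel] at a1
      linarith [H₂ p, hv p]
    · have := H₁ (f - f₀) k1
      simp only [hsum]
      exact this
  have hfs : (chart φ).symm f ∈ (chart ψ).source := by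
    intro p
    rw [chart_symm_apply φ f hft, hsum p]
    have a1 := norm_add_le (φ p + (f₀ p : UnitAddCircle) - ψ p)
      ((f p - f₀ p : ℝ) : UnitAddCircle)
    have a2 := norm_coe_le (f p - f₀ p)
    have a3 := H₃ p
    have a4 := hv p
    rw [show φ p + (f₀ p : UnitAddCircle) + ((f p - f₀ p : ℝ) : UnitAddCircle) - ψ p =
      φ p + (f₀ p : UnitAddCircle) - ψ p + ((f p - f₀ p : ℝ) : UnitAddCircle) by abel]
    linarith
  have hf₀s : (chart φ).symm f₀ ∈ (chart ψ).source := by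
    intro p
    rw [chart_symm_apply φ f₀ ht]
    exact hs p
  refine ⟨by rw [PartialEquiv.trans_source]; exact ⟨hft, hfs⟩, ?_⟩
  refine C.ext fun p => ?_
  rw [PartialEquiv.coe_trans, Function.comp_apply, Function.comp_apply, C.coe_add, Pi.add_apply,
    chart_apply _ _ hfs, chart_apply _ _ hf₀s, chart_symm_apply φ f hft, chart_symm_apply φ f₀ ht,
    C.coe_sub, Pi.sub_apply, ← rep_add (hs p) ((hv p).trans_lt k4), hsum p]
  congr 1
  abel

/-- The atlas of `Diff^n(S¹)` formed by the charts centred at all its points. -/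
def core (n : ℕ) (hn : 1 ≤ n) : ChartedSpaceCore (C n) (D n) where
  atlas := range chart
  chartAt := chart
  mem_chart_source φ p := by simp
  chart_mem_atlas φ := mem_range_self φ
  open_source := by
    rintro _ _ ⟨φ, rfl⟩ ⟨ψ, rfl⟩
    refine Metric.isOpen_iff.2 fun f₀ h₀ => ?_
    obtain ⟨ε, hε, H⟩ := chart_trans hn φ ψ f₀ h₀
    exact ⟨ε, hε, fun f hf => (H f hf).1⟩
  continuousOn_toFun := by
    rintro _ _ ⟨φ, rfl⟩ ⟨ψ, rfl⟩ f₀ h₀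
    obtain ⟨ε, hε, H⟩ := chart_trans hn φ ψ f₀ h₀
    have hc : ContinuousAt (fun f => ((chart φ).symm.trans (chart ψ)) f₀ + (f - f₀)) f₀ := by
      fun_prop
    refine (hc.congr ?_).continuousWithinAt
    filter_upwards [ball_mem_nhds f₀ hε] with f hf using (H f hf).2.symm

section Manifold

variable {n : ℕ} [hn : Fact (3 ≤ n)]

instance : TopologicalSpace (D n) :=
  (core n (le_trans (by norm_num) hn.out)).toTopologicalSpace

/-- `Diff^n(S¹)` is modelled on the Banach space `C^n(S¹)`. -/
instance : ChartedSpace (C n) (D n) :=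
  (core n (le_trans (by norm_num) hn.out)).toChartedSpace

/-- `Diff^n(S¹)` is a smooth manifold. -/
instance : IsManifold 𝓘(ℝ, C n) ∞ (D n) := by
  have hn1 : 1 ≤ n := le_trans (by norm_num) hn.out
  refine isManifold_of_contDiffOn _ _ _ ?_
  intro e e' he he'
  obtain ⟨e₀, he₀, rfl⟩ : ∃ e₀, ∃ h : e₀ ∈ (core n hn1).atlas,
      e = (core n hn1).openPartialHomeomorph e₀ h := by
    have : e ∈ ⋃ (e₀ : PartialEquiv (D n) (C n)) (h : e₀ ∈ (core n hn1).atlas),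
      {(core n hn1).openPartialHomeomorph e₀ h} := he
    simpa only [mem_iUnion, mem_singleton_iff] using this
  obtain ⟨e₁, he₁, rfl⟩ : ∃ e₀, ∃ h : e₀ ∈ (core n hn1).atlas,
      e' = (core n hn1).openPartialHomeomorph e₀ h := by
    have : e' ∈ ⋃ (e₀ : PartialEquiv (D n) (C n)) (h : e₀ ∈ (core n hn1).atlas),
      {(core n hn1).openPartialHomeomorph e₀ h} := he'
    simpa only [mem_iUnion, mem_singleton_iff] using this
  obtain ⟨φ, rfl⟩ := he₀
  obtain ⟨ψ, rfl⟩ := he₁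
  intro f₀ h₀
  obtain ⟨ε, hε, H⟩ := chart_trans hn1 φ ψ f₀ h₀.1
  have hc : ContDiffAt ℝ ∞ (fun f => ((chart φ).symm.trans (chart ψ)) f₀ + (f - f₀)) f₀ := by
    fun_prop
  refine (hc.congr_of_eventuallyEq ?_).contDiffWithinAt
  filter_upwards [ball_mem_nhds f₀ hε] with f hf using (H f hf).2

end Manifold

/-! ### The geodesic vector field -/

/-- The mean value `μ(f) = ∫₀¹ f dx`. -/
def mean (f : UnitAddCircle → ℝ) : ℝ := ∫ x in (0 : ℝ)..1, f (x : UnitAddCircle)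

/-- The operator `A = μ - ∂_x²`. -/
def opA (f : UnitAddCircle → ℝ) : UnitAddCircle → ℝ := fun p => mean f - dx (dx f) p

/-- The inverse `A⁻¹` of the operator `A` on the functions of class `C²`. -/
def invA (g : UnitAddCircle → ℝ) : UnitAddCircle → ℝ := invFunOn opA {w | IsC 2 w} g

theorem integral_primitive {h : ℝ → ℝ} (hc : Continuous h) (hp : Function.Periodic h 1)
    (hm : ∫ x in (0 : ℝ)..1, h x = 0) : Function.Periodic (fun x => ∫ y in (0 : ℝ)..x, h y) 1 := by
  intro x
  have h1 := intervalIntegral.integral_add_adjacent_intervals (μ := MeasureTheory.volume)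
    (hc.intervalIntegrable 0 x) (hc.intervalIntegrable x (x + 1))
  have h2 := hp.intervalIntegral_add_eq x 0
  rw [zero_add, hm] at h2
  simp only
  rw [← h1, h2, add_zero]

theorem deriv_primitive {h : ℝ → ℝ} (hc : Continuous h) :
    deriv (fun x => ∫ y in (0 : ℝ)..x, h y) = h :=
  funext fun x => (hc.integral_hasStrictDerivAt 0 x).hasDerivAt.deriv

theorem contDiff_primitive {h : ℝ → ℝ} {k : ℕ} (hc : ContDiff ℝ k h) :
    ContDiff ℝ (k + 1 : ℕ) (fun x => ∫ y in (0 : ℝ)..x, h y) := by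
  push_cast
  refine contDiff_succ_iff_deriv.2 ⟨fun x => (hc.continuous.integral_hasStrictDerivAt 0
    x).hasDerivAt.differentiableAt, by simp, ?_⟩
  rw [deriv_primitive hc.continuous]
  exact hc

theorem exists_opA_eq {g : UnitAddCircle → ℝ} (hg : IsC 0 g) : ∃ w, IsC 2 w ∧ opA w = g := by
  set G : ℝ → ℝ := fun x => g (x : UnitAddCircle) with hG
  have hGc : Continuous G := ContDiff.continuous hg
  set m : ℝ := ∫ x in (0 : ℝ)..1, G x with hm
  have hGp : Function.Periodic G 1 := fun x => by
    simp only [hG]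
    exact congrArg g (AddCircle.coe_add_period 1 x)
  set h : ℝ → ℝ := fun x => m - G x with hh
  have hhc : ContDiff ℝ (0 : ℕ) h := contDiff_const.sub hg
  have hhp : Function.Periodic h 1 := fun x => by simp only [hh, hGp x]
  have hh0 : ∫ x in (0 : ℝ)..1, h x = 0 := by
    rw [intervalIntegral.integral_sub (by simp) (hGc.intervalIntegrable _ _)]
    simp [hm]
  set H₁ : ℝ → ℝ := fun x => ∫ y in (0 : ℝ)..x, h y with hH₁
  have hH₁p : Function.Periodic H₁ 1 := integral_primitive hhc.continuous hhp hh0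
  have hH₁c : ContDiff ℝ (1 : ℕ) H₁ := contDiff_primitive hhc
  set c : ℝ := ∫ x in (0 : ℝ)..1, H₁ x with hcdef
  set K : ℝ → ℝ := fun x => H₁ x - c with hK
  have hKc : ContDiff ℝ (1 : ℕ) K := hH₁c.sub contDiff_const
  have hKp : Function.Periodic K 1 := fun x => by simp only [hK, hH₁p x]
  have hK0 : ∫ x in (0 : ℝ)..1, K x = 0 := by
    rw [intervalIntegral.integral_sub (hH₁c.continuous.intervalIntegrable _ _) (by simp)]
    simp [hcdef]
  set H₂ : ℝ → ℝ := fun x => ∫ y in (0 : ℝ)..x, K y with hH₂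
  have hH₂p : Function.Periodic H₂ 1 := integral_primitive hKc.continuous hKp hK0
  have hH₂c : ContDiff ℝ (2 : ℕ) H₂ := contDiff_primitive hKc
  set d : ℝ := ∫ x in (0 : ℝ)..1, H₂ x with hd
  set W : ℝ → ℝ := fun x => H₂ x + (m - d) with hW
  have hWp : Function.Periodic W 1 := fun x => by simp only [hW, hH₂p x]
  have hpull : (fun x : ℝ => hWp.lift (x : UnitAddCircle)) = W :=
    funext fun x => hWp.lift_coe x
  refine ⟨hWp.lift, ?_, ?_⟩
  · unfold IsC
    rw [hpull]
    exact hH₂c.add contDiff_const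
  · have hmean : mean hWp.lift = m := by
      unfold mean
      rw [hpull, hW, intervalIntegral.integral_add (hH₂c.continuous.intervalIntegrable _ _)
        (by simp)]
      simp [hd]
    have hW1 : deriv W = K := by
      rw [← deriv_primitive hKc.continuous]
      funext x
      exact deriv_add_const _
    have hK1 : deriv K = h := by
      rw [← deriv_primitive hhc.continuous]
      funext x
      exact deriv_sub_const _
    funext p
    induction p using QuotientAddGroup.induction_on with
    | H x =>
      have e : dx (dx hWp.lift) (x : UnitAddCircle) = h x := by
        rw [dx_coe, pull_dx, hpull, hW1, hK1]
      unfold opA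
      erw [e, hmean]
      simp [hh, hG]

theorem invA_spec {g : UnitAddCircle → ℝ} (hg : IsC 0 g) : IsC 2 (invA g) ∧ opA (invA g) = g :=
  ⟨invFunOn_mem (exists_opA_eq hg), invFunOn_eq (exists_opA_eq hg)⟩

/-- `A⁻¹` maps `C^k(S¹)` into `C^{k+2}(S¹)`. -/
theorem IsC.invA {k : ℕ} {g : UnitAddCircle → ℝ} (hg : IsC k g) : IsC (k + 2) (invA g) := by
  obtain ⟨h2, hA⟩ := invA_spec (hg.mono (Nat.zero_le k))
  set w := MuDP.invA g with hw
  have hdd : MuDP.dx (MuDP.dx w) = fun p => mean w - g p := by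
    funext p
    have := congrFun hA p
    simp only [opA] at this
    linarith
  have h0 : IsC k (MuDP.dx (MuDP.dx w)) := by
    rw [hdd]
    exact ContDiff.sub contDiff_const hg
  have up : ∀ {j l : ℕ} {f : UnitAddCircle → ℝ}, 1 ≤ l → IsC l f → IsC j (MuDP.dx f) →
      IsC (j + 1) f := by
    intro j l f hl hf hdf
    unfold IsC at hdf ⊢
    rw [pull_dx] at hdf
    push_cast
    exact contDiff_succ_iff_deriv.2 ⟨hf.differentiable hl, by simp, hdf⟩
  exact up (l := 2) (by norm_num) h2 (up (l := 1) le_rfl h2.dx h0)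

/-- The operator `P(f) = 3 A⁻¹(f_x f_xx + (A f) f_x)`. -/
def opP (f : UnitAddCircle → ℝ) : UnitAddCircle → ℝ :=
  (3 : ℝ) • invA (dx f * dx (dx f) + opA f * dx f)

theorem IsC.opP {n : ℕ} (hn : 2 ≤ n) {f : UnitAddCircle → ℝ} (hf : IsC n f) : IsC n (opP f) := by
  obtain ⟨k, rfl⟩ : ∃ k, n = k + 2 := ⟨n - 2, by omega⟩
  have h1 : IsC (k + 1) (MuDP.dx f) := IsC.dx hf
  have h2 : IsC k (MuDP.dx (MuDP.dx f)) := h1.dx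
  have h1' : IsC k (MuDP.dx f) := h1.mono (by omega)
  have hA : IsC k (opA f) := ContDiff.sub contDiff_const h2
  exact IsC.smul 3 (IsC.invA ((h1'.mul h2).add (hA.mul h1')))

/-- The operator `P_φ = R_φ ∘ P ∘ R_{φ⁻¹}`, where `R_φ(f) = f ∘ φ`. -/
def conjP {n : ℕ} (φ : D n) (ξ : UnitAddCircle → ℝ) : UnitAddCircle → ℝ :=
  opP (ξ ∘ φ.toEquiv.symm) ∘ φ

theorem IsC.conjP {n : ℕ} (hn : 2 ≤ n) (φ : D n) {ξ : UnitAddCircle → ℝ} (hξ : IsC n ξ) :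
    IsC n (conjP φ ξ) :=
  IsC.comp_diff (IsC.opP hn (hξ.comp_symm (by omega) φ)) φ

section Flow

variable (n : ℕ) [hn : Fact (3 ≤ n)]

/-- The manifold `Diff^n(S¹) × C^n(S¹)`. -/
abbrev TD : Type := D n × C n

/-- The model of the manifold `Diff^n(S¹) × C^n(S¹)`. -/
abbrev model : ModelWithCorners ℝ (C n × C n) (ModelProd (C n) (C n)) :=
  𝓘(ℝ, C n).prod 𝓘(ℝ, C n)

/-- The vector field `F(φ, ξ) = (ξ, -P_φ(ξ))`. The tangent space of `Diff^n(S¹)` at `φ` is `C^n(S¹)`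
by means of the chart centred at `φ`. -/
def field : (z : TD n) → TangentSpace (model n) z :=
  fun z => ((z.2, -C.mk (conjP z.1 z.2) (IsC.conjP (le_trans (by norm_num) hn.out) z.1 z.2.isC)) :
    C n × C n)

/-- `γ = (φ, ξ)` is of class `C^∞` on `J` with values in `Diff^n(S¹) × C^n(S¹)`, satisfies
`(φ_t, ξ_t) = F(φ, ξ)` on `J`, and starts at `(id, u₀)` at time `0`. -/
structure IsSolution (J : Set ℝ) (u₀ : C n) (γ : ℝ → TD n) : Prop where
  smooth : ContMDiffOn 𝓘(ℝ, ℝ) (model n) ∞ γ J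
  ode : IsMIntegralCurveOn γ (field n) J
  init : γ 0 = (D.id n, u₀)

end Flow

end MuDP

end

/-!
# Local well-posedness of the `μ`-Degasperis-Procesi equation on `Diff^n(S¹) × C^n(S¹)`

The vector field `F(φ, ξ) = (ξ, -P_φ(ξ))` involves the composition with `φ⁻¹`, which is not smooth on
`C^n(S¹)`. The point is that `F` is nevertheless *polynomial* in the chart centred at the identity.
The second order terms of `P` cancel, so that `P(u) = 3 μ(u) A⁻¹(u_x)`, and one integration shows
that `P(u) = 3 w`, where `w` has mean zero and `w_x = μ(u) (μ(u) - u)` (`opP_eq`). For `φ = id + f`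
and `u = ξ ∘ φ⁻¹`, the change of variables `φ` turns `μ(u)` into `m = ∫ ξ (1 + f_x)`, and `w ∘ φ`
into the primitive of `m (m - ξ) (1 + f_x)` whose mean value against `1 + f_x` vanishes. Hence `P_φ(ξ)`
is obtained from `(f, ξ)` by derivatives `C^n → C^{n-1}`, products in `C^{n-1}`, primitives
`C^{n-1} → C^n` and mean values (`conjP_eq_coordP`), all of which are continuous (multi)linear.

The local flow is constructed for any vector field `V` on a Banach space `E` such that `β ↦ V ∘ β` is
analytic on the space of continuous paths `[0, 1] → E` (`exists_analytic_flow`). The rescaled solution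
`β(s) = Ψ(t s, u)` solves `β = u + t ∫₀ˢ V(β)`; at `t = 0` the derivative of this equation in `β` is
the identity, and the implicit function theorem gives `β` as an analytic function of `(t, u)`. Then
`Ψ(t, u) = β(1)`, and the differential equation for `Ψ` follows from the uniqueness in the implicit
function theorem, applied to the reparametrisations of `β`. Analyticity is used instead of
smoothness because it holds in a neighbourhood as soon as it holds at a point, which fails for
`ContDiffAt ℝ ∞`: there the neighbourhood may depend on the order of differentiation. The
superposition operator of a polynomial vector field is analytic, because continuous bilinear maps
act on continuous paths (`AnalyticSuperposition.bilin`).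

Changes of charts of `Diff^n(S¹)` are translations, so integral curves of `F` are solutions of an
ordinary differential equation in the chart centred at the identity (`hasMFDerivAt_field_iff`).
Uniqueness holds among all integral curves, including those that might leave this chart: two of
them agree on a set that is closed, as `Diff^n(S¹)` is Hausdorff, and open, as the flow remains in
the chart, where the Cauchy-Lipschitz theorem applies (`eqOn_of_isMIntegralCurveOn`).
-/

noncomputable section

namespace MuDP

/-! ### Analytic superposition operators -/

section Superposition

variable {E F G H : Type*} [NormedAddCommGroup E] [NormedSpace ℝ E] [NormedAddCommGroup F]
  [NormedSpace ℝ F] [NormedAddCommGroup G] [NormedSpace ℝ G] [NormedAddCommGroup H]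
  [NormedSpace ℝ H]

/-- The superposition operator `β ↦ V ∘ β` of the map `V : E → F` sends continuous paths
`[0, 1] → E` to continuous paths in `F`, and is analytic as a map between the Banach spaces of
continuous paths. -/
def AnalyticSuperposition (V : E → F) : Prop :=
  ∃ N : C(unitInterval, E) → C(unitInterval, F), ContDiff ℝ ω N ∧ ∀ β s, N β s = V (β s)

/-- The constant paths, as a continuous linear map. -/
def constPath (E : Type*) [NormedAddCommGroup E] [NormedSpace ℝ E] :
    E →L[ℝ] C(unitInterval, E) :=
  LinearMap.mkContinuous
    { toFun := fun x => ContinuousMap.const _ x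
      map_add' := fun _ _ => rfl
      map_smul' := fun _ _ => rfl } 1 fun x => by
    rw [one_mul]
    exact (ContinuousMap.norm_le _ (norm_nonneg x)).2 fun _ => le_rfl

@[simp] theorem constPath_apply (x : E) (s : unitInterval) : constPath E x s = x := rfl

namespace AnalyticSuperposition

theorem const (c : F) : AnalyticSuperposition (fun _ : E => c) :=
  ⟨fun _ => constPath F c, contDiff_const, fun _ _ => rfl⟩

theorem clm (T : E →L[ℝ] F) : AnalyticSuperposition T :=
  ⟨T.compLeftContinuous ℝ unitInterval, ContinuousLinearMap.contDiff _, fun _ _ => rfl⟩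

theorem clm_comp (T : F →L[ℝ] G) {V : E → F} (hV : AnalyticSuperposition V) :
    AnalyticSuperposition (fun x => T (V x)) := by
  obtain ⟨N, hN, h⟩ := hV
  refine ⟨fun β => T.compLeftContinuous ℝ unitInterval (N β),
    (ContinuousLinearMap.contDiff _).comp hN, fun β s => ?_⟩
  exact congrArg T (h β s)

theorem add {V W : E → F} (hV : AnalyticSuperposition V) (hW : AnalyticSuperposition W) :
    AnalyticSuperposition (fun x => V x + W x) := by
  obtain ⟨N, hN, h⟩ := hV
  obtain ⟨M, hM, h'⟩ := hW
  exact ⟨fun β => N β + M β, hN.add hM, fun β s => by simp [h, h']⟩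

theorem neg {V : E → F} (hV : AnalyticSuperposition V) : AnalyticSuperposition (fun x => -V x) := by
  obtain ⟨N, hN, h⟩ := hV
  exact ⟨fun β => -N β, hN.neg, fun β s => by simp [h]⟩

theorem sub {V W : E → F} (hV : AnalyticSuperposition V) (hW : AnalyticSuperposition W) :
    AnalyticSuperposition (fun x => V x - W x) := by
  simpa only [sub_eq_add_neg] using hV.add hW.neg

theorem prodMk {V : E → F} {W : E → G} (hV : AnalyticSuperposition V)
    (hW : AnalyticSuperposition W) : AnalyticSuperposition (fun x => (V x, W x)) := by
  have := (clm_comp (ContinuousLinearMap.inl ℝ F G) hV).add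
    (clm_comp (ContinuousLinearMap.inr ℝ F G) hW)
  simpa using this

theorem bilin (B : F →L[ℝ] G →L[ℝ] H) {V : E → F} {W : E → G} (hV : AnalyticSuperposition V)
    (hW : AnalyticSuperposition W) : AnalyticSuperposition (fun x => B (V x) (W x)) := by
  obtain ⟨N, hN, h⟩ := hV
  obtain ⟨M, hM, h'⟩ := hW
  let b : C(unitInterval, F) × C(unitInterval, G) → C(unitInterval, H) := fun p =>
    ⟨fun s => B (p.1 s) (p.2 s), by fun_prop⟩
  have hb : IsBoundedBilinearMap ℝ b :=
    { add_left := fun x₁ x₂ y => by ext s; simp [b]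
      smul_left := fun c x y => by ext s; simp [b]
      add_right := fun x y₁ y₂ => by ext s; simp [b]
      smul_right := fun c x y => by ext s; simp [b]
      bound := by
        refine ⟨‖B‖ + 1, by positivity, fun x y => ?_⟩
        refine (ContinuousMap.norm_le _ (by positivity)).2 fun s => ?_
        refine (B.le_opNorm₂ (x s) (y s)).trans ?_
        gcongr
        · linarith
        · exact x.norm_coe_le_norm s
        · exact y.norm_coe_le_norm s }
  refine ⟨fun β => b (N β, M β), hb.contDiff.comp (hN.prodMk hM), fun β s => ?_⟩
  change B (N β s) (M β s) = _
  rw [h, h']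

/-- Restricting the superposition operator to constant paths. -/
theorem contDiff {V : E → F} (hV : AnalyticSuperposition V) : ContDiff ℝ ω V := by
  obtain ⟨N, hN, h⟩ := hV
  have h2 : ContDiff ℝ ω fun x =>
      ContinuousMap.evalCLM ℝ (0 : unitInterval) (N (constPath E x)) :=
    (ContinuousLinearMap.contDiff _).comp (hN.comp (constPath E).contDiff)
  convert h2 using 2 with x
  change _ = N _ _
  rw [h]
  rfl

end AnalyticSuperposition

end Superposition

/-! ### The analytic local flow of a vector field on a Banach space -/

section Flow

variable {E : Type*} [NormedAddCommGroup E]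

/-- Reparametrisation of a path: `s ↦ β(τ s)`. -/
def rescale (τ : unitInterval) (β : C(unitInterval, E)) : C(unitInterval, E) :=
  β.comp ⟨fun s => τ * s, by fun_prop⟩

theorem rescale_apply (τ : unitInterval) (β : C(unitInterval, E)) (s : unitInterval) :
    rescale τ β s = β (τ * s) := rfl

variable [NormedSpace ℝ E]

/-- The operator `β ↦ (s ↦ ∫₀ˢ β)` on the continuous paths `[0, 1] → E`. -/
def pathIntegral (E : Type*) [NormedAddCommGroup E] [NormedSpace ℝ E] :
    C(unitInterval, E) →L[ℝ] C(unitInterval, E) :=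
  LinearMap.mkContinuous
    { toFun := fun β => ⟨fun s => ∫ σ in (0 : ℝ)..s, IccExtend zero_le_one β σ, by
        have hc : Continuous (IccExtend (zero_le_one (α := ℝ)) β) := β.continuous.Icc_extend'
        exact (intervalIntegral.continuous_primitive
          (fun a b => hc.intervalIntegrable a b) 0).comp continuous_subtype_val⟩
      map_add' := fun β β' => by
        ext s
        exact intervalIntegral.integral_add (β.continuous.Icc_extend'.intervalIntegrable _ _)
          (β'.continuous.Icc_extend'.intervalIntegrable _ _)
      map_smul' := fun c β => by
        ext s
        exact intervalIntegral.integral_smul _ _ } 1 fun β => by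
    refine (ContinuousMap.norm_le _ (by positivity)).2 fun s => ?_
    have h := intervalIntegral.norm_integral_le_of_norm_le_const (a := 0) (b := (s : ℝ))
      (f := IccExtend (zero_le_one (α := ℝ)) β) (C := ‖β‖)
      fun x _ => β.norm_coe_le_norm _
    refine h.trans ?_
    rw [sub_zero, abs_of_nonneg s.2.1, mul_comm]
    exact mul_le_mul_of_nonneg_right s.2.2 (norm_nonneg _)

theorem pathIntegral_apply (β : C(unitInterval, E)) (s : unitInterval) :
    pathIntegral E β s = ∫ σ in (0 : ℝ)..s, IccExtend zero_le_one β σ := rfl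

theorem pathIntegral_rescale (τ : unitInterval) (β : C(unitInterval, E)) :
    (τ : ℝ) • pathIntegral E (rescale τ β) = rescale τ (pathIntegral E β) := by
  ext s
  change (τ : ℝ) • pathIntegral E (rescale τ β) s = pathIntegral E β (τ * s)
  rw [pathIntegral_apply, pathIntegral_apply]
  have h := intervalIntegral.smul_integral_comp_mul_left (a := 0) (b := (s : ℝ))
    (IccExtend (zero_le_one (α := ℝ)) β) (τ : ℝ)
  rw [mul_zero] at h
  rw [show ((τ * s : unitInterval) : ℝ) = (τ : ℝ) * s from rfl, ← h]
  congr 1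
  refine intervalIntegral.integral_congr fun σ hσ => ?_
  rw [uIcc_of_le s.2.1] at hσ
  have h1 : σ ∈ Icc (0 : ℝ) 1 := ⟨hσ.1, hσ.2.trans s.2.2⟩
  have h2 : (τ : ℝ) * σ ∈ Icc (0 : ℝ) 1 := unitInterval.mul_mem τ.2 h1
  rw [IccExtend_of_mem _ _ h1, IccExtend_of_mem _ _ h2]
  rfl

variable [CompleteSpace E]

/-- A vector field with analytic superposition operator has an analytic local flow near every point. -/
theorem exists_analytic_flow {V : E → E} (hV : AnalyticSuperposition V) (x₀ : E) :
    ∃ Ψ : ℝ × E → E, ∃ ε > (0 : ℝ), ∃ δ > (0 : ℝ),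
      ContDiffOn ℝ ω Ψ (Ioo (-ε) ε ×ˢ ball x₀ δ) ∧
      (∀ u ∈ ball x₀ δ, Ψ (0, u) = u) ∧
      ∀ u ∈ ball x₀ δ, ∀ t ∈ Ioo (-ε) ε,
        HasDerivAt (fun τ => Ψ (τ, u)) (V (Ψ (t, u))) t := by
  have hVc := hV.contDiff.continuous
  obtain ⟨N, hN, hNV⟩ := hV
  -- the path equation `β = u + t ∫₀ V(β)`, whose solution is `β(s) = Ψ(t s, u)`
  let f : (ℝ × E) × C(unitInterval, E) → C(unitInterval, E) := fun z =>
    z.2 - constPath E z.1.2 - z.1.1 • pathIntegral E (N z.2)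
  have hf : ContDiff ℝ ω f := by
    have h1 := hN.comp (contDiff_snd (𝕜 := ℝ) (E := ℝ × E) (F := C(unitInterval, E)))
    have h2 := (pathIntegral E).contDiff.comp h1
    have h3 := (constPath E).contDiff.comp
      (contDiff_snd.comp (contDiff_fst (𝕜 := ℝ) (n := ω) (E := ℝ × E) (F := C(unitInterval, E))))
    have h4 := (contDiff_fst.comp
      (contDiff_fst (𝕜 := ℝ) (n := ω) (E := ℝ × E) (F := C(unitInterval, E))))
    exact (contDiff_snd.sub h3).sub (h4.smul h2)
  set z₀ : (ℝ × E) × C(unitInterval, E) := ((0, x₀), constPath E x₀) with hz₀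
  have hf0 : f z₀ = 0 := by simp [f, hz₀]
  have hcd : ContDiffAt ℝ ω f z₀ := hf.contDiffAt
  have hpn : (ω : WithTop ℕ∞) ≠ 0 := by simp
  -- at `t = 0` the equation is `β - u = 0`, so its derivative in `β` is the identity
  have hinv : (fderiv ℝ f z₀ ∘L .inr ℝ (ℝ × E) C(unitInterval, E)).IsInvertible := by
    have h1 : HasFDerivAt f (fderiv ℝ f z₀) z₀ :=
      (hf.differentiable (by simp) z₀).hasFDerivAt
    have h2 : HasFDerivAt (fun β : C(unitInterval, E) => (((0, x₀) : ℝ × E), β))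
        (.inr ℝ (ℝ × E) C(unitInterval, E)) (constPath E x₀) :=
      hasFDerivAt_prodMk_right _ _
    have h3 := HasFDerivAt.comp (g := f) (constPath E x₀) h1 h2
    have h4 : f ∘ (fun β : C(unitInterval, E) => (((0, x₀) : ℝ × E), β)) =
        fun β => β - constPath E x₀ := by
      funext β; simp [f]
    rw [h4] at h3
    have h5 := h3.unique ((hasFDerivAt_id (constPath E x₀)).sub_const (constPath E x₀))
    rw [h5]
    exact ⟨ContinuousLinearEquiv.refl ℝ _, rfl⟩
  set ψ := hcd.implicitFunction hpn hinv with hψ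
  have hψ0 : ψ (0, x₀) = constPath E x₀ := hcd.implicitFunction_apply_self hpn hinv
  have hψs : ContDiffAt ℝ ω ψ (0, x₀) := hcd.contDiffAt_implicitFunction hpn hinv
  have hψe : ∀ᶠ x in 𝓝 ((0, x₀) : ℝ × E), f (x, ψ x) = 0 := by
    have := hcd.eventually_apply_implicitFunction hpn hinv
    rwa [hf0] at this
  have hψu : ∀ᶠ v in 𝓝 z₀, f v = 0 ↔ ψ v.1 = v.2 := by
    have := hcd.eventually_apply_eq_iff_implicitFunction hpn hinv
    rwa [hf0] at this
  obtain ⟨r, hr, hru⟩ := Metric.eventually_nhds_iff_ball.1 hψu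
  have hclose : ∀ᶠ x in 𝓝 ((0, x₀) : ℝ × E), ψ x ∈ ball (constPath E x₀) r := by
    have := hψs.continuousAt
    rw [ContinuousAt, hψ0] at this
    exact this (ball_mem_nhds _ hr)
  obtain ⟨η₀, hη₀, hη⟩ := Metric.eventually_nhds_iff_ball.1
    (hclose.and (hψe.and (hψs.eventually (by simp))))
  set η := min η₀ r with hηdef
  have hη0 : 0 < η := lt_min hη₀ hr
  have hball : ∀ t ∈ Ioo (-η) η, ∀ u ∈ ball x₀ η, ((t, u) : ℝ × E) ∈ ball ((0, x₀) : ℝ × E) η :=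
    fun t ht u hu => by
      rw [← ball_prod_same]
      exact ⟨by rw [Real.ball_eq_Ioo]; simpa using ht, hu⟩
  have hmul : ∀ τ : unitInterval, ∀ t ∈ Ioo (-η) η, (τ : ℝ) * t ∈ Ioo (-η) η := fun τ t ht => by
    rw [mem_Ioo, ← abs_lt] at ht ⊢
    rw [abs_mul, abs_of_nonneg τ.2.1]
    exact (mul_le_of_le_one_left (abs_nonneg t) τ.2.2).trans_lt ht
  -- a rescaled solution of the path equation solves it for the rescaled time
  have hscale : ∀ t ∈ Ioo (-η) η, ∀ u ∈ ball x₀ η, ∀ τ : unitInterval,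
      ψ ((τ : ℝ) * t, u) = rescale τ (ψ (t, u)) := by
    intro t ht u hu τ
    obtain ⟨h1, h2, -⟩ := hη (t, u) (ball_subset_ball (min_le_left _ _) (hball t ht u hu))
    have hmem : ((((τ : ℝ) * t, u) : ℝ × E), rescale τ (ψ (t, u))) ∈ ball z₀ r := by
      rw [hz₀, ← ball_prod_same]
      refine ⟨ball_subset_ball (min_le_right _ _) (hball _ (hmul τ t ht) u hu), ?_⟩
      rw [mem_ball] at h1 ⊢
      refine lt_of_le_of_lt ((ContinuousMap.dist_le dist_nonneg).2 fun s => ?_) h1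
      exact ContinuousMap.dist_apply_le_dist (f := ψ (t, u)) (g := constPath E x₀) (τ * s)
    refine (hru _ hmem).1 ?_
    have hNr : N (rescale τ (ψ (t, u))) = rescale τ (N (ψ (t, u))) := by
      ext s
      rw [rescale_apply, hNV, hNV, rescale_apply]
    change rescale τ (ψ (t, u)) - constPath E u -
      ((τ : ℝ) * t) • pathIntegral E (N (rescale τ (ψ (t, u)))) = 0
    rw [hNr, mul_comm, mul_smul, pathIntegral_rescale]
    have h3 := congrArg (rescale τ) h2
    exact h3
  have hcdΨ : ContDiffOn ℝ ω (fun x : ℝ × E => ψ x 1) (Ioo (-η) η ×ˢ ball x₀ η) := by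
    intro x hx
    obtain ⟨-, -, h3⟩ := hη x
      (ball_subset_ball (min_le_left _ _) (hball x.1 hx.1 x.2 hx.2))
    let ev : C(unitInterval, E) →L[ℝ] E := ContinuousMap.evalCLM ℝ (1 : unitInterval)
    have h4 : ContDiffAt ℝ ω (ev ∘ ψ) x := ContDiffAt.comp x ev.contDiff.contDiffAt h3
    exact h4.contDiffWithinAt
  have hint : ∀ u ∈ ball x₀ η, ∀ t ∈ Ioo (-η) η,
      ψ (t, u) 1 = u + ∫ τ in (0 : ℝ)..t, V (ψ (τ, u) 1) := by
    intro u hu t ht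
    obtain ⟨-, h2, -⟩ := hη (t, u) (ball_subset_ball (min_le_left _ _) (hball t ht u hu))
    have h3 := congrArg (fun β : C(unitInterval, E) => β 1) h2
    change ψ (t, u) 1 - u - t • pathIntegral E (N (ψ (t, u))) 1 = 0 at h3
    have h4 : t • pathIntegral E (N (ψ (t, u))) 1 = ∫ τ in (0 : ℝ)..t, V (ψ (τ, u) 1) := by
      have h5 := intervalIntegral.smul_integral_comp_mul_right (a := 0) (b := 1)
        (fun τ => V (ψ (τ, u) 1)) t
      rw [zero_mul, one_mul] at h5
      rw [← h5, pathIntegral_apply]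
      congr 1
      refine intervalIntegral.integral_congr fun σ hσ => ?_
      rw [show ((1 : unitInterval) : ℝ) = 1 from rfl, uIcc_of_le zero_le_one] at hσ
      have h6 := hscale t ht u hu ⟨σ, hσ⟩
      rw [IccExtend_of_mem _ _ hσ, hNV]
      simp only at h6 ⊢
      rw [h6, rescale_apply, mul_one]
    rw [h4] at h3
    rw [sub_sub, sub_eq_zero] at h3
    exact h3
  refine ⟨fun x => ψ x 1, η, hη0, η, hη0, hcdΨ, fun u hu => ?_, fun u hu t ht => ?_⟩
  · have := hint u hu 0 ⟨by linarith, hη0⟩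
    simpa using this
  · have hco : ContinuousOn (fun τ => V (ψ (τ, u) 1)) (Ioo (-η) η) :=
      hVc.comp_continuousOn (hcdΨ.continuousOn.comp (by fun_prop) fun τ hτ => ⟨hτ, hu⟩)
    have h0 : (0 : ℝ) ∈ Ioo (-η) η := ⟨by linarith, hη0⟩
    have hsub : uIcc 0 t ⊆ Ioo (-η) η := ordConnected_Ioo.uIcc_subset h0 ht
    have hd := intervalIntegral.integral_hasDerivAt_right
      ((hco.mono hsub).intervalIntegrable)
      (hco.stronglyMeasurableAtFilter isOpen_Ioo t ht)
      (hco.continuousAt (isOpen_Ioo.mem_nhds ht))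
    refine (hd.const_add u).congr_of_eventuallyEq ?_
    filter_upwards [isOpen_Ioo.mem_nhds ht] with τ hτ using hint u hu τ hτ

end Flow

/-! ### Completeness of `C^n(S¹)` -/

theorem IsC.succ {k : ℕ} {f : UnitAddCircle → ℝ}
    (hf : Differentiable ℝ (fun x : ℝ => f (x : UnitAddCircle))) (h : IsC k (MuDP.dx f)) :
    IsC (k + 1) f := by
  unfold IsC at h ⊢
  rw [pull_dx] at h
  push_cast
  exact contDiff_succ_iff_deriv.2 ⟨hf, by simp, h⟩

theorem continuous_pull {f : UnitAddCircle → ℝ} (hf : Continuous f) :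
    Continuous (fun x : ℝ => f (x : UnitAddCircle)) :=
  hf.comp (AddCircle.continuous_mk' 1)

theorem periodic_pull (f : UnitAddCircle → ℝ) :
    Function.Periodic (fun x : ℝ => f (x : UnitAddCircle)) 1 :=
  fun x => congrArg f (AddCircle.coe_add_period 1 x)

theorem dx_eq_of_hasDerivAt {f g : UnitAddCircle → ℝ}
    (h : ∀ x : ℝ, HasDerivAt (fun y : ℝ => f (y : UnitAddCircle)) (g (x : UnitAddCircle)) x) :
    dx f = g := by
  funext p
  induction p using QuotientAddGroup.induction_on with
  | H x =>
    erw [dx_coe]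
    exact (h x).deriv

theorem IsC.hasDerivAt {f : UnitAddCircle → ℝ} (hf : IsC 1 f) (x : ℝ) :
    HasDerivAt (fun y : ℝ => f (y : UnitAddCircle)) (MuDP.dx f (x : UnitAddCircle)) x := by
  rw [dx_coe]
  exact (hf.differentiable le_rfl x).hasDerivAt

/-- The families `(g₀, …, g_n)` of continuous functions that are jets of `C^n`-functions are those
with `g_j(x) = g_j(0) + ∫₀ˣ g_{j+1}`; this form of the condition is closed under uniform limits. -/
theorem range_jet (n : ℕ) :
    range (C.jet n) = {g | ∀ j : Fin n, ∀ x : ℝ, g j.castSucc (x : UnitAddCircle) =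
      g j.castSucc (0 : ℝ) + ∫ y in (0 : ℝ)..x, g j.succ (y : UnitAddCircle)} := by
  ext g
  constructor
  · rintro ⟨f, rfl⟩ j x
    have h1 : IsC 1 (dx^[(j : ℕ)] f) := IsC.iter_dx (f.isC.mono (by have := j.2; omega))
    have h2 : ∀ y ∈ uIcc 0 x, HasDerivAt (fun y : ℝ => (dx^[(j : ℕ)] f) (y : UnitAddCircle))
        (C.jet n f j.succ (y : UnitAddCircle)) y := fun y _ => by
      have := h1.hasDerivAt y
      rwa [← Function.iterate_succ_apply' dx] at this
    rw [intervalIntegral.integral_eq_sub_of_hasDerivAt h2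
      ((continuous_pull (C.jet n f j.succ).continuous).intervalIntegrable _ _)]
    simp [C.jet_apply]
  · intro hg
    have hd : ∀ j : Fin n, ∀ x : ℝ, HasDerivAt (fun y : ℝ => g j.castSucc (y : UnitAddCircle))
        (g j.succ (x : UnitAddCircle)) x := fun j x => by
      have h1 := ((continuous_pull (g j.succ).continuous).integral_hasStrictDerivAt 0
        x).hasDerivAt.const_add (g j.castSucc ((0 : ℝ) : UnitAddCircle))
      exact h1.congr_of_eventuallyEq (Filter.Eventually.of_forall fun y => hg j y)
    have hdx : ∀ j : Fin n, dx (g j.castSucc) = g j.succ := fun j => dx_eq_of_hasDerivAt (hd j)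
    have hC : ∀ i j : ℕ, ∀ h : j + i < n + 1, IsC i (g ⟨j, by omega⟩) := by
      intro i
      induction i with
      | zero => exact fun j h => contDiff_zero.2 (continuous_pull (g _).continuous)
      | succ i ih =>
        intro j h
        refine IsC.succ (fun x => (hd ⟨j, by omega⟩ x).differentiableAt) ?_
        have := hdx ⟨j, by omega⟩
        rw [show (⟨j, by omega⟩ : Fin (n + 1)) = Fin.castSucc ⟨j, by omega⟩ from rfl, this]
        exact ih (j + 1) (by omega)
    refine ⟨C.mk (g 0) (hC n 0 (by omega)), ?_⟩
    have hit : ∀ j : ℕ, ∀ h : j < n + 1, dx^[j] (g 0) = g ⟨j, h⟩ := by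
      intro j
      induction j with
      | zero => exact fun _ => rfl
      | succ j ih =>
        intro h
        rw [Function.iterate_succ_apply', ih (by omega)]
        exact hdx ⟨j, by omega⟩
    funext j
    ext p
    exact congrFun (hit j j.2) p

instance (n : ℕ) : CompleteSpace (C n) := by
  have hi : Isometry (C.jet n) := AddMonoidHomClass.isometry_of_norm _ fun _ => rfl
  rw [completeSpace_iff_isComplete_range hi.isUniformInducing]
  refine IsClosed.isComplete ?_
  rw [range_jet]
  simp only [ofPred_forall]
  refine isClosed_iInter fun j => isClosed_iInter fun x => isClosed_eq (by fun_prop) ?_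
  refine Continuous.add (by fun_prop) ?_
  refine intervalIntegral.continuous_parametric_intervalIntegral_of_continuous' ?_ 0 x
  have : Continuous fun p : (Fin (n + 1) → C(UnitAddCircle, ℝ)) × ℝ =>
      p.1 j.succ (p.2 : UnitAddCircle) := by
    have := AddCircle.continuous_mk' (1 : ℝ)
    fun_prop
  exact this

/-! ### Operators on the spaces `C^n(S¹)` -/

namespace C

variable {k : ℕ}

theorem norm_le {f : C k} {c : ℝ} (hc : 0 ≤ c) (h : ∀ j ≤ k, ∀ p, |(dx^[j] f) p| ≤ c) :
    ‖f‖ ≤ c := by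
  rw [norm_def]
  refine (pi_norm_le_iff_of_nonneg hc).2 fun j => (ContinuousMap.norm_le _ hc).2 fun p => ?_
  exact h j (by have := j.2; omega) p

theorem abs_mean_le (f : C k) : |mean f| ≤ ‖f‖ := by
  have h := intervalIntegral.norm_integral_le_of_norm_le_const (a := (0 : ℝ)) (b := 1)
    (f := fun x : ℝ => f (x : UnitAddCircle)) (C := ‖f‖) fun x _ => f.abs_le _
  simpa [mean] using h

theorem intervalIntegrable (f : C k) (a b : ℝ) :
    IntervalIntegrable (fun x : ℝ => f (x : UnitAddCircle)) MeasureTheory.volume a b :=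
  (continuous_pull f.isC.continuous).intervalIntegrable a b

/-- The mean value as a continuous linear form. -/
def meanL (k : ℕ) : C k →L[ℝ] ℝ :=
  LinearMap.mkContinuous
    { toFun := fun f => mean f
      map_add' := fun f g =>
        intervalIntegral.integral_add (f.intervalIntegrable 0 1) (g.intervalIntegrable 0 1)
      map_smul' := fun c f => intervalIntegral.integral_const_mul c _ } 1
    fun f => by rw [one_mul]; exact f.abs_mean_le

/-- The inclusion of `C^{k+1}(S¹)` in `C^k(S¹)`. -/
def inclL (k : ℕ) : C (k + 1) →L[ℝ] C k :=
  LinearMap.mkContinuous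
    { toFun := fun f => mk f (f.isC.mono (Nat.le_succ k))
      map_add' := fun _ _ => rfl
      map_smul' := fun _ _ => rfl } 1 fun f => by
    rw [one_mul]
    exact norm_le (norm_nonneg f) fun j hj p => f.abs_iter_dx_le (by omega) p

@[simp] theorem inclL_apply (f : C (k + 1)) (p : UnitAddCircle) : inclL k f p = f p := rfl

/-- The derivative from `C^{k+1}(S¹)` to `C^k(S¹)`. -/
def dxL (k : ℕ) : C (k + 1) →L[ℝ] C k :=
  LinearMap.mkContinuous
    { toFun := fun f => mk (dx f) f.isC.dx
      map_add' := fun f g => ext fun p =>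
        congrFun (dx_add (f.isC.mono (by omega)) (g.isC.mono (by omega))) p
      map_smul' := fun c f => ext fun p => congrFun (dx_smul c (f.isC.mono (by omega))) p } 1
    fun f => by
    rw [one_mul]
    refine norm_le (norm_nonneg f) fun j hj p => ?_
    have := f.abs_iter_dx_le (Nat.succ_le_succ hj) p
    rwa [Function.iterate_succ_apply] at this

@[simp] theorem dxL_apply (f : C (k + 1)) (p : UnitAddCircle) : dxL k f p = dx f p := rfl

end C

theorem dx_mul {f g : UnitAddCircle → ℝ} (hf : IsC 1 f) (hg : IsC 1 g) :
    dx (f * g) = dx f * g + f * dx g :=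
  dx_eq_of_hasDerivAt fun x => (hf.hasDerivAt x).mul (hg.hasDerivAt x)

/-- The estimate behind the continuity of the multiplication of `C^k(S¹)`. -/
theorem abs_iter_dx_mul_le (k : ℕ) {f g : UnitAddCircle → ℝ} {a b : ℝ} (hf : IsC k f)
    (hg : IsC k g) (ha : ∀ j ≤ k, ∀ p, |(dx^[j] f) p| ≤ a)
    (hb : ∀ j ≤ k, ∀ p, |(dx^[j] g) p| ≤ b) :
    ∀ j ≤ k, ∀ p, |(dx^[j] (f * g)) p| ≤ 2 ^ k * (a * b) := by
  have ha0 : 0 ≤ a := (abs_nonneg _).trans (ha 0 (Nat.zero_le k) 0)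
  have hb0 : 0 ≤ b := (abs_nonneg _).trans (hb 0 (Nat.zero_le k) 0)
  induction k generalizing f g with
  | zero =>
    intro j hj p
    obtain rfl : j = 0 := by omega
    simp only [Function.iterate_zero, id_eq, Pi.mul_apply, abs_mul, pow_zero, one_mul]
    exact mul_le_mul (ha 0 le_rfl p) (hb 0 le_rfl p) (abs_nonneg _) ha0
  | succ k ih =>
    intro j hj p
    cases j with
    | zero =>
      simp only [Function.iterate_zero, id_eq, Pi.mul_apply, abs_mul]
      have h1 := mul_le_mul (ha 0 (by omega) p) (hb 0 (by omega) p) (abs_nonneg _) ha0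
      have h2 : (1 : ℝ) ≤ 2 ^ (k + 1) := one_le_pow₀ (by norm_num)
      exact h1.trans (le_mul_of_one_le_left (mul_nonneg ha0 hb0) h2)
    | succ j =>
      rw [Function.iterate_succ_apply, dx_mul (hf.mono (by omega)) (hg.mono (by omega))]
      have hf' : IsC k f := hf.mono (by omega)
      have hg' : IsC k g := hg.mono (by omega)
      rw [iter_dx_add ((hf.dx.mul hg').mono (by omega)) ((hf'.mul hg.dx).mono (by omega))]
      have e1 := ih hf.dx hg' (fun i hi q => ha (i + 1) (by omega) q)
        (fun i hi q => hb i (by omega) q) j (by omega) p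
      have e2 := ih hf' hg.dx (fun i hi q => ha i (by omega) q)
        (fun i hi q => hb (i + 1) (by omega) q) j (by omega) p
      refine (abs_add_le _ _).trans ((add_le_add e1 e2).trans (le_of_eq ?_))
      ring

namespace C

variable {k : ℕ}

/-- The multiplication of `C^k(S¹)`. -/
def mulL (k : ℕ) : C k →L[ℝ] C k →L[ℝ] C k :=
  LinearMap.mkContinuous₂
    (LinearMap.mk₂ ℝ (fun f g => mk (f * g) (f.isC.mul g.isC))
      (fun _ _ _ => ext fun _ => add_mul _ _ _) (fun _ _ _ => ext fun _ => mul_assoc _ _ _)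
      (fun _ _ _ => ext fun _ => mul_add _ _ _)
      (fun _ _ _ => ext fun _ => mul_left_comm _ _ _)) (2 ^ k) fun f g => by
    rw [mul_assoc]
    exact norm_le (by positivity) (abs_iter_dx_mul_le k f.isC g.isC
      (fun j hj p => f.abs_iter_dx_le hj p) (fun j hj p => g.abs_iter_dx_le hj p))

@[simp] theorem mulL_apply (f g : C k) (p : UnitAddCircle) : mulL k f g p = f p * g p := rfl

/-- The constant functions on the circle. -/
def constL (k : ℕ) : ℝ →L[ℝ] C k :=
  ContinuousLinearMap.smulRight (1 : ℝ →L[ℝ] ℝ) (mk (fun _ => 1) (IsC.const 1))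

@[simp] theorem constL_apply (c : ℝ) (p : UnitAddCircle) : constL k c p = c := by
  change c * 1 = c
  rw [mul_one]

theorem periodic_primitive (f : C k) :
    Function.Periodic (fun x : ℝ => ∫ y in (0 : ℝ)..x, (f (y : UnitAddCircle) - mean f)) 1 := by
  refine integral_primitive (h := fun y : ℝ => f (y : UnitAddCircle) - mean f)
    ((continuous_pull f.isC.continuous).sub continuous_const)
    (fun x => congrArg (· - mean f) (periodic_pull f x)) ?_
  rw [intervalIntegral.integral_sub (f.intervalIntegrable 0 1) (by simp)]
  simp [mean]

/-- The primitive, vanishing at `0`, of `f - μ(f)`. -/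
def prim (f : C k) : C (k + 1) :=
  mk f.periodic_primitive.lift (by
    unfold IsC
    simp only [Function.Periodic.lift_coe]
    exact contDiff_primitive (f.isC.sub contDiff_const))

theorem prim_coe (f : C k) (x : ℝ) :
    prim f (x : UnitAddCircle) = ∫ y in (0 : ℝ)..x, (f (y : UnitAddCircle) - mean f) :=
  f.periodic_primitive.lift_coe x

theorem hasDerivAt_prim (f : C k) (x : ℝ) :
    HasDerivAt (fun y : ℝ => prim f (y : UnitAddCircle)) (f (x : UnitAddCircle) - mean f) x := by
  simp only [prim_coe]
  exact (((continuous_pull f.isC.continuous).sub continuous_const).integral_hasStrictDerivAt 0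
    x).hasDerivAt

theorem dx_prim (f : C k) : dx (prim f) = f - constL k (mean f) :=
  dx_eq_of_hasDerivAt fun x => by simpa using f.hasDerivAt_prim x

theorem norm_constL_le (c : ℝ) : ‖constL k c‖ ≤ |c| := by
  refine norm_le (abs_nonneg c) fun j hj p => ?_
  have hc : (constL k c : UnitAddCircle → ℝ) = fun _ => c := funext fun p => constL_apply c p
  have h0 : ∀ c : ℝ, dx (fun _ => c) = fun _ => 0 := fun c =>
    dx_eq_of_hasDerivAt fun x => hasDerivAt_const x c
  have h1 : ∀ j : ℕ, ∀ c : ℝ, ∀ p, |(dx^[j] fun _ => c) p| ≤ |c| := by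
    intro j
    induction j with
    | zero => exact fun c p => le_rfl
    | succ j ih =>
      intro c p
      rw [Function.iterate_succ_apply, h0]
      exact (ih 0 p).trans (by simp)
  rw [hc]
  exact h1 j c p

/-- The operator `f ↦ ∫₀ˣ (f - μ(f))` from `C^k(S¹)` to `C^{k+1}(S¹)`. -/
def primL (k : ℕ) : C k →L[ℝ] C (k + 1) :=
  LinearMap.mkContinuous
    { toFun := prim
      map_add' := fun f g => ext fun p => by
        induction p using QuotientAddGroup.induction_on with
        | H x =>
          change _ = prim f _ + prim g _
          erw [prim_coe, prim_coe, prim_coe]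
          rw [← intervalIntegral.integral_add]
          · refine intervalIntegral.integral_congr fun y _ => ?_
            have : mean (f + g : C k) = mean f + mean g := (meanL k).map_add f g
            change (f _ + g _) - mean (f + g : C k) = _
            rw [this]
            ring
          · exact (f.intervalIntegrable _ _).sub (by simp)
          · exact (g.intervalIntegrable _ _).sub (by simp)
      map_smul' := fun c f => ext fun p => by
        induction p using QuotientAddGroup.induction_on with
        | H x =>
          change _ = c * prim f _
          erw [prim_coe, prim_coe]
          rw [← intervalIntegral.integral_const_mul]
          refine intervalIntegral.integral_congr fun y _ => ?_
          have : mean (c • f : C k) = c * mean f := (meanL k).map_smul c f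
          change c * f _ - mean (c • f : C k) = _
          rw [this]
          ring } 2 fun f => by
    have hb : ‖f - constL k (mean f)‖ ≤ 2 * ‖f‖ := by
      have h1 := norm_sub_le f (constL k (mean f))
      have h2 := (norm_constL_le (k := k) (mean f)).trans f.abs_mean_le
      linarith
    refine norm_le (by positivity) fun j hj p => ?_
    cases j with
    | zero =>
      obtain ⟨y, hy, hyp⟩ : ∃ y ∈ Ico (0 : ℝ) 1, (y : UnitAddCircle) = p := by
        have := AddCircle.coe_image_Ico_eq (1 : ℝ) 0
        have hp : p ∈ ((↑) : ℝ → UnitAddCircle) '' Ico 0 (0 + 1) := by rw [this]; trivial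
        simpa using hp
      rw [← hyp]
      change |prim f _| ≤ _
      rw [prim_coe]
      have h := intervalIntegral.norm_integral_le_of_norm_le_const (a := (0 : ℝ)) (b := y)
        (f := fun x : ℝ => f (x : UnitAddCircle) - mean f) (C := 2 * ‖f‖) fun x _ => by
          have := (f - constL k (mean f)).abs_le (x : UnitAddCircle)
          simp only [coe_sub, Pi.sub_apply, constL_apply] at this
          exact this.trans hb
      refine h.trans ?_
      rw [sub_zero, abs_of_nonneg hy.1]
      exact mul_le_of_le_one_right (by positivity) hy.2.le
    | succ j =>
      rw [Function.iterate_succ_apply]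
      change |(dx^[j] (dx (prim f))) p| ≤ _
      rw [dx_prim]
      exact ((f - constL k (mean f)).abs_iter_dx_le (by omega) p).trans hb

end C

/-! ### The geodesic vector field in the chart centred at the identity -/

theorem mean_dx {f : UnitAddCircle → ℝ} (hf : IsC 1 f) : mean (dx f) = 0 := by
  unfold mean
  rw [intervalIntegral.integral_eq_sub_of_hasDerivAt (fun x _ => hf.hasDerivAt x)
    ((continuous_pull (hf.dx (k := 0)).continuous).intervalIntegrable _ _)]
  have := periodic_pull f 0
  simp only [zero_add] at this
  rw [this, sub_self]

theorem eq_const_of_hasDerivAt_zero {f : UnitAddCircle → ℝ}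
    (h : ∀ x : ℝ, HasDerivAt (fun y : ℝ => f (y : UnitAddCircle)) 0 x) : ∃ c, ∀ p, f p = c := by
  refine ⟨f (0 : ℝ), fun p => ?_⟩
  induction p using QuotientAddGroup.induction_on with
  | H x =>
    exact is_const_of_deriv_eq_zero (fun x => (h x).differentiableAt) (fun x => (h x).deriv) x 0

theorem mean_add {f g : UnitAddCircle → ℝ} (hf : Continuous f) (hg : Continuous g) :
    mean (fun p => f p + g p) = mean f + mean g :=
  intervalIntegral.integral_add ((continuous_pull hf).intervalIntegrable _ _)
    ((continuous_pull hg).intervalIntegrable _ _)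

theorem mean_const_mul (c : ℝ) (f : UnitAddCircle → ℝ) :
    mean (fun p => c * f p) = c * mean f :=
  intervalIntegral.integral_const_mul c _

theorem mean_add_const_mul {f g : UnitAddCircle → ℝ} (hf : Continuous f) (hg : Continuous g)
    (c : ℝ) : mean (fun p => f p + c * g p) = mean f + c * mean g := by
  rw [← mean_const_mul]
  exact mean_add hf (continuous_const.mul hg)

theorem mean_const (c : ℝ) : mean (fun _ => c) = c := by simp [mean]

/-- The second order terms of `P` cancel, which leaves `P(u) = 3 μ(u) A⁻¹(u_x)`; integrating once,
`P(u) = 3 w` where `w` has mean zero and `w_x = μ(u) (μ(u) - u)`. -/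
theorem opP_eq {u : UnitAddCircle → ℝ} (hu : IsC 1 u) :
    ∃ w, IsC 2 w ∧ mean w = 0 ∧ (∀ p, dx w p = mean u * (mean u - u p)) ∧
      ∀ p, opP u p = 3 * w p := by
  set m := mean u with hm
  have hsrc : dx u * dx (dx u) + opA u * dx u = m • dx u := by
    funext p
    simp only [Pi.add_apply, Pi.mul_apply, Pi.smul_apply, smul_eq_mul, opA]
    ring
  have hux : IsC 0 (dx u) := hu.dx
  obtain ⟨hw, hA⟩ := invA_spec (hux.smul m)
  set w := invA (m • dx u) with hwdef
  have hw1 : IsC 1 (dx w) := hw.dx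
  have hw2 : IsC 0 (dx (dx w)) := hw1.dx
  have hAp : ∀ p, mean w + -1 * dx (dx w) p = m * dx u p := fun p => by
    have := congrFun hA p
    simp only [opA, Pi.smul_apply, smul_eq_mul] at this
    linarith
  have hmw : mean w = 0 := by
    have h1 : mean (fun p => mean w + -1 * dx (dx w) p) = mean w := by
      rw [mean_add_const_mul continuous_const hw2.continuous, mean_const, mean_dx hw1]
      ring
    rw [← h1, funext hAp, mean_const_mul, mean_dx hu, mul_zero]
  obtain ⟨c, hc⟩ := eq_const_of_hasDerivAt_zero (f := fun p => dx w p + m * u p) fun x => by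
    refine ((hw1.hasDerivAt x).add ((hu.hasDerivAt x).const_mul m)).congr_deriv ?_
    have := hAp (x : UnitAddCircle)
    rw [hmw] at this
    linarith
  have hcm : c = m * m := by
    rw [← mean_const c, ← funext hc, mean_add_const_mul hw1.continuous hu.continuous,
      mean_dx (hw.mono (by norm_num)), zero_add]
  refine ⟨w, hw, hmw, fun p => ?_, fun p => ?_⟩
  · have := hc p
    rw [hcm] at this
    linarith
  · rw [opP, hsrc]
    rfl

section Coordinates

variable {k : ℕ}

/-- Change of variables by the map `p ↦ p + f(p)`, whose derivative is `1 + f_x`. -/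
theorem mean_comp_mul {h : UnitAddCircle → ℝ} (hh : Continuous h) (f : C (k + 1)) :
    mean (fun p => h (p + (f p : UnitAddCircle)) * (1 + dx f p)) = mean h := by
  have hf : IsC 1 f := f.isC.mono (by omega)
  have hL : ∀ x : ℝ, HasDerivAt (fun y : ℝ => y + f (y : UnitAddCircle))
      (1 + dx f (x : UnitAddCircle)) x := fun x => (hasDerivAt_id x).add (hf.hasDerivAt x)
  have h1 := intervalIntegral.integral_comp_mul_deriv (a := 0) (b := 1)
    (f := fun y : ℝ => y + f (y : UnitAddCircle))
    (f' := fun y : ℝ => 1 + dx f (y : UnitAddCircle))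
    (g := fun y : ℝ => h (y : UnitAddCircle)) (fun x _ => hL x)
    (continuous_const.add (continuous_pull (hf.dx (k := 0)).continuous)).continuousOn
    (continuous_pull hh)
  have h2 := (periodic_pull h).intervalIntegral_add_eq (0 + f ((0 : ℝ) : UnitAddCircle)) 0
  have h3 := periodic_pull f 0
  simp only [zero_add] at h2 h3
  unfold mean
  simp only [zero_add, Function.comp_apply, AddCircle.coe_add] at h1
  rw [h1, h3, add_comm (1 : ℝ), h2]

/-- The derivative `1 + f_x` of `p ↦ p + f(p)`. -/
def jac (f : C (k + 1)) : C k := C.constL k 1 + C.dxL k f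

theorem jac_apply (f : C (k + 1)) (p : UnitAddCircle) : jac f p = 1 + dx f p := by
  simp [jac]

/-- The mean value `∫ ξ (1 + f_x) = μ(ξ ∘ φ⁻¹)`, where `φ = id + f`. -/
def coordMean (z : C (k + 1) × C (k + 1)) : ℝ :=
  C.meanL k (C.mulL k (C.inclL k z.2) (jac z.1))

/-- A primitive of `(m - ξ) (1 + f_x)`, where `m = ∫ ξ (1 + f_x)`. -/
def coordPrim (z : C (k + 1) × C (k + 1)) : C (k + 1) :=
  C.primL k (C.mulL k (C.constL k (coordMean z) - C.inclL k z.2) (jac z.1))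

/-- The expression of `P_φ(ξ)`, where `φ = id + f`, as a polynomial function of `(f, ξ)`. -/
def coordP (z : C (k + 1) × C (k + 1)) : C (k + 1) :=
  ContinuousLinearMap.lsmul ℝ ℝ (3 * coordMean z) (coordPrim z -
    C.constL (k + 1) (C.meanL k (C.mulL k (C.inclL k (coordPrim z)) (jac z.1))))

/-- The vector field `F` in the chart centred at the identity. -/
def coordField (z : C (k + 1) × C (k + 1)) : C (k + 1) × C (k + 1) := (z.2, -coordP z)

theorem analyticSuperposition_coordField :
    AnalyticSuperposition (coordField (k := k)) := by
  have h1 : AnalyticSuperposition fun z : C (k + 1) × C (k + 1) => z.1 :=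
    .clm (ContinuousLinearMap.fst ℝ (C (k + 1)) (C (k + 1)))
  have h2 : AnalyticSuperposition fun z : C (k + 1) × C (k + 1) => z.2 :=
    .clm (ContinuousLinearMap.snd ℝ (C (k + 1)) (C (k + 1)))
  have hj : AnalyticSuperposition fun z : C (k + 1) × C (k + 1) => jac z.1 :=
    (AnalyticSuperposition.const _).add (h1.clm_comp (C.dxL k))
  have hm : AnalyticSuperposition (coordMean (k := k)) :=
    (AnalyticSuperposition.bilin (C.mulL k) (h2.clm_comp (C.inclL k)) hj).clm_comp (C.meanL k)
  have hp : AnalyticSuperposition (coordPrim (k := k)) :=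
    (AnalyticSuperposition.bilin (C.mulL k)
      ((hm.clm_comp (C.constL k)).sub (h2.clm_comp (C.inclL k))) hj).clm_comp (C.primL k)
  have h3 : AnalyticSuperposition fun z : C (k + 1) × C (k + 1) => 3 * coordMean z :=
    hm.clm_comp ((3 : ℝ) • ContinuousLinearMap.id ℝ ℝ)
  have hP : AnalyticSuperposition (coordP (k := k)) :=
    AnalyticSuperposition.bilin (ContinuousLinearMap.lsmul ℝ ℝ) h3
      (hp.sub (((AnalyticSuperposition.bilin (C.mulL k) (hp.clm_comp (C.inclL k))
        hj).clm_comp (C.meanL k)).clm_comp (C.constL (k + 1))))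
  exact h2.prodMk hP.neg

theorem conjP_eq_coordP (φ : D (k + 1)) (f ξ : C (k + 1))
    (hφ : ∀ p, φ p = p + (f p : UnitAddCircle)) (p : UnitAddCircle) :
    conjP φ ξ p = coordP (f, ξ) p := by
  have hf : IsC 1 f := f.isC.mono (by omega)
  set u := (ξ : UnitAddCircle → ℝ) ∘ φ.toEquiv.symm with hu
  have huC : IsC 1 u := (ξ.isC.comp_symm (by omega) φ).mono (by omega)
  have huφ : ∀ q : UnitAddCircle, u (q + (f q : UnitAddCircle)) = ξ q := fun q => by
    rw [← hφ]
    exact congrArg ξ (φ.toEquiv.symm_apply_apply q)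
  obtain ⟨w, hw, hmw, hwx, hP⟩ := opP_eq huC
  set m := coordMean (f, ξ) with hmdef
  have hm : mean u = m := by
    rw [← mean_comp_mul huC.continuous f]
    simp only [huφ, ← jac_apply]
    rfl
  rw [hm] at hwx
  set g := C.mulL k (C.constL k m - C.inclL k ξ) (jac f) with hg
  have hgp : ∀ q, g q = (m - ξ q) * (1 + dx f q) := fun q => by
    rw [hg, C.mulL_apply, jac_apply]
    simp
  have hmg : mean g = 0 := by
    have h1 := mean_comp_mul (h := fun q => m + -1 * u q)
      (continuous_const.add (continuous_const.mul huC.continuous)) f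
    rw [mean_add_const_mul continuous_const huC.continuous, mean_const, hm] at h1
    simp only [huφ] at h1
    rw [funext hgp]
    simp only [sub_eq_add_neg, neg_mul, one_mul] at h1 ⊢
    rw [h1]
    ring
  have hGdef : coordPrim (f, ξ) = C.prim g := rfl
  set G := coordPrim (f, ξ) with hG
  obtain ⟨c, hc⟩ := eq_const_of_hasDerivAt_zero
    (f := fun q => w (q + (f q : UnitAddCircle)) - m * G q) fun x => by
      have hL : HasDerivAt (fun y : ℝ => y + f (y : UnitAddCircle))
        (1 + dx f (x : UnitAddCircle)) x := (hasDerivAt_id x).add (hf.hasDerivAt x)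
      have h1 := ((hw.mono (k := 1) (by norm_num)).hasDerivAt
        (x + f (x : UnitAddCircle))).comp x hL
      have h2 := g.hasDerivAt_prim x
      rw [← hGdef] at h2
      refine (h1.sub (h2.const_mul m)).congr_deriv ?_
      rw [AddCircle.coe_add, hwx, huφ, hgp, hmg]
      ring
  have hjm : mean (fun q => 1 + dx f q) = 1 := by
    rw [mean_add continuous_const (hf.dx (k := 0)).continuous, mean_const, mean_dx hf, add_zero]
  have hjc : Continuous fun q => 1 + dx f q := continuous_const.add (hf.dx (k := 0)).continuous
  have hcm : c = -(m * mean (fun q => G q * (1 + dx f q))) := by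
    have h1 := mean_comp_mul hw.continuous f
    have h2 : (fun q => w (q + (f q : UnitAddCircle)) * (1 + dx f q)) =
        fun q => m * (G q * (1 + dx f q)) + c * (1 + dx f q) := by
      funext q
      rw [← hc q]
      ring
    have hGc : Continuous fun q => m * (G q * (1 + dx f q)) :=
      continuous_const.mul (G.isC.continuous.mul hjc)
    rw [h2, hmw, mean_add_const_mul hGc hjc, mean_const_mul, hjm] at h1
    linarith
  have hmG : C.meanL k (C.mulL k (C.inclL k G) (jac f)) =
      mean (fun q => G q * (1 + dx f q)) := by
    simp only [← jac_apply]
    rfl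
  have hR : coordP (f, ξ) p = 3 * m * (G p - mean (fun q => G q * (1 + dx f q))) := by
    rw [← hmG]
    simp only [coordP, ContinuousLinearMap.lsmul_apply, C.coe_smul, C.coe_sub, Pi.smul_apply,
      Pi.sub_apply, C.constL_apply, smul_eq_mul]
    rfl
  rw [hR]
  change opP u (φ p) = _
  rw [hφ, hP]
  have := hc p
  rw [hcm] at this
  linear_combination 3 * this

end Coordinates

/-! ### The manifold `Diff^n(S¹)` near the identity -/

section Charts

variable {n : ℕ}

theorem coe_eq_add_chart {φ ψ : D n} (h : ψ ∈ (chart φ).source) (p : UnitAddCircle) :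
    ψ p = φ p + (chart φ ψ p : UnitAddCircle) := by
  rw [chart_apply φ ψ h, coe_rep, add_sub_cancel]

theorem continuous_eval (p : UnitAddCircle) : Continuous fun f : C n => f p :=
  (LinearMap.mkContinuous
    ({ toFun := fun f => f p
       map_add' := fun _ _ => rfl
       map_smul' := fun _ _ => rfl } : C n →ₗ[ℝ] ℝ) 1 fun f => by
    rw [one_mul]
    exact f.abs_le p).continuous

variable [hn : Fact (3 ≤ n)]

theorem one_le_of_fact : 1 ≤ n := le_trans (by norm_num) hn.out

theorem isOpen_source_chart (φ : D n) : IsOpen (chart φ).source := (chartAt (C n) φ).open_source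

theorem isOpen_target_chart (φ : D n) : IsOpen (chart φ).target := (chartAt (C n) φ).open_target

theorem continuousOn_chart (φ : D n) : ContinuousOn (chart φ) (chart φ).source :=
  (chartAt (C n) φ).continuousOn

theorem mem_source_chart (φ : D n) : φ ∈ (chart φ).source := mem_chart_source (C n) φ

theorem chart_self (φ : D n) : chart φ φ = 0 := C.ext fun p => by
  rw [chart_apply φ φ (mem_source_chart φ), sub_self]
  exact rep_coe (y := 0) (by norm_num)

instance : T2Space (D n) := by
  refine T2Space.of_injective_continuous (f := fun φ : D n => (φ : UnitAddCircle → UnitAddCircle))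
    DFunLike.coe_injective (continuous_pi fun p => continuous_iff_continuousAt.2 fun φ => ?_)
  have hs := (isOpen_source_chart φ).mem_nhds (mem_source_chart φ)
  have hc : ContinuousAt (fun ψ : D n => φ p + (chart φ ψ p : UnitAddCircle)) φ :=
    continuousAt_const.add ((AddCircle.continuous_mk' 1).continuousAt.comp
      ((continuous_eval p).continuousAt.comp ((continuousOn_chart φ).continuousAt hs)))
  refine hc.congr ?_
  filter_upwards [hs] with ψ hψ using (coe_eq_add_chart hψ p).symm

/-- Near `ψ`, the charts centred at `φ` and at `ψ` differ by a constant. -/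
theorem eventually_chart_eq {φ ψ : D n} (h : ψ ∈ (chart φ).source) :
    ∀ᶠ χ in 𝓝 ψ, chart φ χ = chart φ ψ + chart ψ χ := by
  have hs := (isOpen_source_chart ψ).mem_nhds (mem_source_chart ψ)
  have hψ0 : (chart ψ).symm 0 = ψ := by
    rw [← chart_self ψ]
    exact (chart ψ).left_inv (mem_source_chart ψ)
  have h0 : (0 : C n) ∈ ((chart ψ).symm.trans (chart φ)).source := by
    rw [PartialEquiv.trans_source]
    refine ⟨?_, ?_⟩
    · rw [← chart_self ψ]
      exact (chart ψ).map_source (mem_source_chart ψ)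
    · rw [mem_preimage, hψ0]
      exact h
  obtain ⟨ε, hε, H⟩ := chart_trans one_le_of_fact ψ φ 0 h0
  have hev : ∀ᶠ χ in 𝓝 ψ, chart ψ χ ∈ ball (0 : C n) ε := by
    have := (continuousOn_chart ψ).continuousAt hs
    rw [ContinuousAt, chart_self] at this
    exact this (ball_mem_nhds _ hε)
  filter_upwards [hs, hev] with χ h1 h2
  have h3 := (H _ h2).2
  simp only [PartialEquiv.coe_trans, Function.comp_apply, sub_zero] at h3
  rw [hψ0, (chart ψ).left_inv h1] at h3
  exact h3

/-- The coordinates `(f, ξ)` of `(id + f, ξ)`. -/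
def coord (z : TD n) : C n × C n := (chart (D.id n) z.1, z.2)

/-- The domain of the coordinates centred at the identity. -/
def coordDomain (n : ℕ) [Fact (3 ≤ n)] : Set (TD n) := {z | z.1 ∈ (chart (D.id n)).source}

theorem isOpen_coordDomain : IsOpen (coordDomain n) :=
  (isOpen_source_chart (D.id n)).preimage continuous_fst

theorem continuousOn_coord : ContinuousOn coord (coordDomain n) :=
  ((continuousOn_chart (D.id n)).comp continuousOn_fst fun _ h => h).prodMk continuousOn_snd

theorem injOn_coord : InjOn coord (coordDomain n) := by
  intro z hz z' hz' h
  exact Prod.ext ((chart (D.id n)).injOn hz hz' (congrArg Prod.fst h))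
    (congrArg (Prod.snd (α := C n) (β := C n)) h)

/-- The derivative of a curve in `Diff^n(S¹) × C^n(S¹)` is its derivative in the coordinates
centred at the identity, because the changes of charts are translations. -/
theorem hasMFDerivAt_iff {γ : ℝ → TD n} {t : ℝ} (h : γ t ∈ coordDomain n) (v : C n × C n) :
    HasMFDerivAt 𝓘(ℝ, ℝ) (model n) γ t
      ((1 : ℝ →L[ℝ] ℝ).smulRight (v : TangentSpace (model n) (γ t))) ↔
      ContinuousAt γ t ∧ HasDerivAt (fun τ => coord (γ τ)) v t := by
  have h1 : HasMFDerivAt 𝓘(ℝ, ℝ) (model n) γ t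
      ((1 : ℝ →L[ℝ] ℝ).smulRight (v : TangentSpace (model n) (γ t))) ↔
      ContinuousAt γ t ∧
        HasDerivAt (fun τ => ((chart (γ t).1 (γ τ).1, (γ τ).2) : C n × C n)) v t := by
    have hrange : range 𝓘(ℝ, ℝ) = univ := by simp only [mfld_simps]
    have key : HasFDerivWithinAt (fun τ => ((chart (γ t).1 (γ τ).1, (γ τ).2) : C n × C n))
        ((1 : ℝ →L[ℝ] ℝ).smulRight v) (range 𝓘(ℝ, ℝ)) t ↔
        HasDerivAt (fun τ => ((chart (γ t).1 (γ τ).1, (γ τ).2) : C n × C n)) v t := by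
      rw [hrange, hasFDerivWithinAt_univ, hasDerivAt_iff_hasFDerivAt]
      rfl
    exact and_congr_right fun _ => key
  rw [h1]
  refine and_congr_right fun hc => ?_
  have hev : (fun τ => coord (γ τ)) =ᶠ[𝓝 t] fun τ =>
      ((chart (D.id n) (γ t).1, 0) : C n × C n) + (chart (γ t).1 (γ τ).1, (γ τ).2) := by
    have := (continuous_fst.continuousAt.comp hc).eventually (eventually_chart_eq h)
    filter_upwards [this] with τ hτ
    simp only [Function.comp_apply] at hτ
    simp [coord, hτ]
  rw [hev.hasDerivAt_iff]
  exact (hasDerivAt_const_add_iff _).symm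

end Charts

/-! ### Solutions of the geodesic equation -/

section Solutions

variable {k : ℕ} [hk : Fact (3 ≤ k + 1)]

theorem field_eq_coordField {z : TD (k + 1)} (hz : z ∈ coordDomain (k + 1)) :
    field (k + 1) z = coordField (coord z) := by
  refine Prod.ext rfl (congrArg Neg.neg (C.ext fun p => ?_))
  exact conjP_eq_coordP z.1 (chart (D.id (k + 1)) z.1) z.2
    (fun q => coe_eq_add_chart (φ := D.id (k + 1)) hz q) p

/-- In the coordinates centred at the identity, an integral curve of `F` is a solution of the
ordinary differential equation of `coordField`. -/
theorem hasMFDerivAt_field_iff {γ : ℝ → TD (k + 1)} {t : ℝ} (h : γ t ∈ coordDomain (k + 1)) :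
    HasMFDerivAt 𝓘(ℝ, ℝ) (model (k + 1)) γ t
      ((1 : ℝ →L[ℝ] ℝ).smulRight (field (k + 1) (γ t))) ↔
      ContinuousAt γ t ∧
        HasDerivAt (fun τ => coord (γ τ)) (coordField (coord (γ t))) t := by
  rw [← hasMFDerivAt_iff h, field_eq_coordField h]

/-- Two integral curves, one of which remains in the domain of the coordinates, agree as soon as
they meet. -/
theorem eqOn_of_isMIntegralCurveOn {a b t₀ : ℝ} {γ γ' : ℝ → TD (k + 1)} (ht₀ : t₀ ∈ Ioo a b)
    (hγ : IsMIntegralCurveOn γ (field (k + 1)) (Ioo a b))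
    (hγ' : IsMIntegralCurveOn γ' (field (k + 1)) (Ioo a b))
    (hdom : ∀ t ∈ Ioo a b, γ' t ∈ coordDomain (k + 1)) (h : γ t₀ = γ' t₀) :
    EqOn γ γ' (Ioo a b) := by
  have hat : ∀ {g : ℝ → TD (k + 1)}, IsMIntegralCurveOn g (field (k + 1)) (Ioo a b) →
      ∀ t ∈ Ioo a b, HasMFDerivAt 𝓘(ℝ, ℝ) (model (k + 1)) g t
        ((1 : ℝ →L[ℝ] ℝ).smulRight (field (k + 1) (g t))) := fun hg t ht =>
    (hg t ht).hasMFDerivAt (isOpen_Ioo.mem_nhds ht)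
  have hco : ContinuousOn γ (Ioo a b) := fun t ht => (hγ t ht).continuousWithinAt
  have hco' : ContinuousOn γ' (Ioo a b) := fun t ht => (hγ' t ht).continuousWithinAt
  suffices hsub : Ioo a b ⊆ {t | γ t = γ' t} ∩ Ioo a b from fun t ht => (hsub ht).1
  refine isPreconnected_Ioo.subset_of_closure_inter_subset ?_ ⟨t₀, ht₀, h, ht₀⟩ ?_
  · refine isOpen_iff_mem_nhds.2 fun t ⟨(hγt : γ t = γ' t), ht⟩ => ?_
    have hI := isOpen_Ioo.mem_nhds ht
    obtain ⟨K, s, hs, hlip⟩ := ((analyticSuperposition_coordField (k := k)).contDiff.of_le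
      (by simp) : ContDiff ℝ 1 _).contDiffAt.exists_lipschitzOnWith (x := coord (γ' t))
    have key : ∀ {g : ℝ → TD (k + 1)}, IsMIntegralCurveOn g (field (k + 1)) (Ioo a b) →
        g t = γ' t → ∀ᶠ τ in 𝓝 t, g τ ∈ coordDomain (k + 1) ∧
          HasDerivAt (fun τ => coord (g τ)) (coordField (coord (g τ))) τ ∧
            coord (g τ) ∈ s := by
      intro g hg hgt
      have hgc : ContinuousAt g t := (hat hg t ht).continuousAt
      have hgd : g t ∈ coordDomain (k + 1) := hgt ▸ hdom t ht
      have e1 := hgc.eventually (isOpen_coordDomain.mem_nhds hgd)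
      have e2 : ∀ᶠ τ in 𝓝 t, coord (g τ) ∈ s := by
        have hcc := (continuousOn_coord.continuousAt (isOpen_coordDomain.mem_nhds hgd)).comp hgc
        refine hcc.eventually ?_
        rw [Function.comp_apply, hgt]
        exact hs
      filter_upwards [e1, e2, hI] with τ h1 h2 h3
      exact ⟨h1, ((hasMFDerivAt_field_iff h1).1 (hat hg τ h3)).2, h2⟩
    have hu := ODE_solution_unique_of_eventually (v := fun _ => coordField) (s := fun _ => s)
      (.of_forall fun _ => hlip) ((key hγ hγt).mono fun _ h => h.2)
      ((key hγ' rfl).mono fun _ h => h.2) (congrArg coord hγt)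
    filter_upwards [hu, key hγ hγt, key hγ' rfl, hI] with τ h1 h2 h3 h4
    exact ⟨injOn_coord h2.1 h3.1 h1, h4⟩
  · rintro t ⟨hcl, ht⟩
    refine ⟨?_, ht⟩
    have hne : (𝓝[{t | γ t = γ' t} ∩ Ioo a b] t).NeBot := mem_closure_iff_nhdsWithin_neBot.1 hcl
    have l1 := ((hco t ht).mono_left (nhdsWithin_mono t
      (inter_subset_right (s := {t | γ t = γ' t}))) : Filter.Tendsto γ _ (𝓝 (γ t)))
    have l2 := ((hco' t ht).mono_left (nhdsWithin_mono t
      (inter_subset_right (s := {t | γ t = γ' t}))) : Filter.Tendsto γ' _ (𝓝 (γ' t)))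
    refine tendsto_nhds_unique (l1.congr' ?_) l2
    filter_upwards [self_mem_nhdsWithin] with τ hτ using hτ.1

end Solutions

end MuDP

end

open MuDP in
theorem theorem3 (n : ℕ) [Fact (3 ≤ n)] :
    ∃ ε > (0 : ℝ), ∃ δ > (0 : ℝ), ∃ Φ : ℝ × MuDP.C n → MuDP.D n × MuDP.C n,
      (∀ u₀ ∈ Metric.ball (0 : MuDP.C n) δ,
        MuDP.IsSolution n (Set.Ioo (-ε) ε) u₀ (fun t => Φ (t, u₀)) ∧
        ∀ γ : ℝ → MuDP.D n × MuDP.C n, MuDP.IsSolution n (Set.Ioo (-ε) ε) u₀ γ →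
          Set.EqOn γ (fun t => Φ (t, u₀)) (Set.Ioo (-ε) ε)) ∧
      ContMDiffOn 𝓘(ℝ, ℝ × MuDP.C n) (MuDP.model n) ∞ Φ
        (Set.Ioo (-ε) ε ×ˢ Metric.ball (0 : MuDP.C n) δ) := by
  -- the coordinate expression of `F` passes through `C^{n-1}(S¹)`
  obtain ⟨k, rfl⟩ : ∃ k, n = k + 1 :=
    ⟨n - 1, by have := Fact.out (p := 3 ≤ n); omega⟩
  obtain ⟨Ψ, ε₀, hε₀, δ₀, hδ₀, hΨ, hΨ0, hΨd⟩ :=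
    exists_analytic_flow (analyticSuperposition_coordField (k := k)) (0 : C (k + 1) × C (k + 1))
  set T := (chart (D.id (k + 1))).target with hT
  have hTo : IsOpen T := isOpen_target_chart _
  have h0T : (0 : C (k + 1)) ∈ T := by
    rw [← chart_self (D.id (k + 1))]
    exact (chart _).map_source (mem_source_chart _)
  -- the flow remains in the target of the chart for small times and small initial values
  have hcont : ContinuousAt Ψ (0, 0) :=
    hΨ.continuousOn.continuousAt (prod_mem_nhds (Ioo_mem_nhds (by linarith) hε₀)
      (ball_mem_nhds _ hδ₀))
  have hev : ∀ᶠ x in 𝓝 ((0 : ℝ), (0 : C (k + 1) × C (k + 1))), (Ψ x).1 ∈ T := by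
    refine (continuous_fst.continuousAt.comp hcont).eventually (hTo.mem_nhds ?_)
    rw [Function.comp_apply, hΨ0 0 (mem_ball_self hδ₀)]
    exact h0T
  obtain ⟨r, hr, hrT⟩ := Metric.eventually_nhds_iff_ball.1 hev
  set ε := min ε₀ r with hε
  set δ := min δ₀ r with hδ
  have hε0 : 0 < ε := lt_min hε₀ hr
  have hδ0 : 0 < δ := lt_min hδ₀ hr
  have hεsub : Ioo (-ε) ε ⊆ Ioo (-ε₀) ε₀ :=
    Ioo_subset_Ioo (neg_le_neg (min_le_left _ _)) (min_le_left _ _)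
  -- the initial value `(id, u)` has the coordinates `(0, u)`
  let ι : C (k + 1) → C (k + 1) × C (k + 1) := fun u => (0, u)
  have hι : ∀ u ∈ ball (0 : C (k + 1)) δ, ι u ∈ ball 0 δ₀ := fun u hu => by
    rw [← Prod.mk_zero_zero, ← ball_prod_same]
    exact ⟨mem_ball_self hδ₀, ball_subset_ball (min_le_left _ _) hu⟩
  have hmemT : ∀ t ∈ Ioo (-ε) ε, ∀ u ∈ ball (0 : C (k + 1)) δ, (Ψ (t, ι u)).1 ∈ T := by
    intro t ht u hu
    refine hrT _ ?_
    rw [← ball_prod_same, ← Prod.mk_zero_zero, ← ball_prod_same]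
    refine ⟨ball_subset_ball (min_le_right ε₀ r) ?_, mem_ball_self hr,
      ball_subset_ball (min_le_right _ _) hu⟩
    rw [Real.ball_eq_Ioo]
    rwa [zero_sub, zero_add]
  let Φ : ℝ × C (k + 1) → D (k + 1) × C (k + 1) := fun x =>
    ((chart (D.id (k + 1))).symm (Ψ (x.1, ι x.2)).1, (Ψ (x.1, ι x.2)).2)
  have hΨι : ContDiffOn ℝ ∞ (fun x : ℝ × C (k + 1) => Ψ (x.1, ι x.2))
      (Ioo (-ε) ε ×ˢ ball 0 δ) := by
    refine (hΨ.of_le le_top).comp (g := Ψ) (f := fun x : ℝ × C (k + 1) => (x.1, ι x.2)) ?_ ?_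
    · exact ContDiff.contDiffOn (by fun_prop)
    · exact fun x hx => ⟨hεsub hx.1, hι _ hx.2⟩
  have hΦ : ContMDiffOn 𝓘(ℝ, ℝ × C (k + 1)) (model (k + 1)) ∞ Φ (Ioo (-ε) ε ×ˢ ball 0 δ) := by
    refine ContMDiffOn.prodMk ?_ ?_
    · have h1 : ContMDiffOn 𝓘(ℝ, C (k + 1)) 𝓘(ℝ, C (k + 1)) ∞
          (chartAt (C (k + 1)) (D.id (k + 1))).symm (chartAt (C (k + 1)) (D.id (k + 1))).target :=
        contMDiffOn_chart_symm
      exact h1.comp (contDiff_fst.comp_contDiffOn hΨι).contMDiffOn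
        fun x hx => hmemT x.1 hx.1 x.2 hx.2
    · exact (contDiff_snd.comp_contDiffOn hΨι).contMDiffOn
  have hsol : ∀ u₀ ∈ ball (0 : C (k + 1)) δ,
      IsSolution (k + 1) (Ioo (-ε) ε) u₀ (fun t => Φ (t, u₀)) := by
    intro u₀ hu₀
    have hsm : ContMDiffOn 𝓘(ℝ, ℝ) (model (k + 1)) ∞ (fun t => Φ (t, u₀)) (Ioo (-ε) ε) := by
      have hin : ContDiff ℝ ∞ (fun t : ℝ => (t, u₀)) := by fun_prop
      exact hΦ.comp hin.contDiffOn.contMDiffOn fun t ht => ⟨ht, hu₀⟩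
    refine ⟨hsm, fun t ht => HasMFDerivAt.hasMFDerivWithinAt ?_, ?_⟩
    · have hcoord : ∀ τ ∈ Ioo (-ε) ε, coord (Φ (τ, u₀)) = Ψ (τ, ι u₀) := fun τ hτ =>
        Prod.ext ((chart (D.id (k + 1))).right_inv (hmemT τ hτ u₀ hu₀)) rfl
      have hdom : Φ (t, u₀) ∈ coordDomain (k + 1) :=
        (chart (D.id (k + 1))).map_target (hmemT t ht u₀ hu₀)
      refine (hasMFDerivAt_field_iff (γ := fun t => Φ (t, u₀)) hdom).2 ⟨?_, ?_⟩
      · exact hsm.continuousOn.continuousAt (isOpen_Ioo.mem_nhds ht)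
      · rw [hcoord t ht]
        refine (hΨd (ι u₀) (hι u₀ hu₀) t (hεsub ht)).congr_of_eventuallyEq ?_
        filter_upwards [isOpen_Ioo.mem_nhds ht] with τ hτ using hcoord τ hτ
    · have h1 : Ψ (0, ι u₀) = (0, u₀) := hΨ0 _ (hι u₀ hu₀)
      refine Prod.ext ?_ (congrArg (Prod.snd (α := C (k + 1)) (β := C (k + 1))) h1)
      refine D.ext fun p => ?_
      change (chart (D.id (k + 1))).symm (Ψ (0, ι u₀)).1 p = p
      rw [h1, chart_symm_apply _ _ h0T]
      change p + ((0 : ℝ) : UnitAddCircle) = p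
      simp
  refine ⟨ε, hε0, δ, hδ0, Φ, fun u₀ hu₀ => ⟨hsol u₀ hu₀, fun γ hγ => ?_⟩, hΦ⟩
  refine eqOn_of_isMIntegralCurveOn (t₀ := 0) ⟨by linarith, hε0⟩ hγ.ode (hsol u₀ hu₀).ode
    (fun t ht => (chart (D.id (k + 1))).map_target (hmemT t ht u₀ hu₀)) ?_
  exact hγ.init.trans (hsol u₀ hu₀).init.symm
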